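/- Let $\Bbbk$ be a field of characteristic zero. Let $c\mathsf{Com}$ be the category of cosimplicial commutative $\Bbbk$-algebras and $\mathsf{cdga}$ the category of commutative dg $\Bbbk$-algebras, cohomologically graded in non-negative degrees. For $n\ge 0$ let $\Lambda^n=\Bbbk[e_0,\dots,e_n]$ be the free graded commutative algebra on generators of degree $-1$, with the derivation $e_i\mapsto 1$ as differential; a map $\alpha\colon[m]\to[n]$ acts by $e_i\mapsto e_{\alpha(i)}$. Let $K^\bullet_{\mathrm{alg}}\colon \mathsf{cdga}\to c\mathsf{Com}$ be the Dold–Kan functor $K^n_{\mathrm{alg}}(C)=Z^0(C\otimes\Lambda^n)$. It has a left adjoint $D^\ast$. A cosimplicial algebra $A^\bullet$ is *reduced* if $A^0=\Bbbk$; then $\mathfrak m^n_A=\ker(A^n\to A^0)$ is its augmentation ideal, and $\widehat A^\bullet$, with $\widehat A^n=\varprojlim_i A^n/(\mathfrak m_A^n)^i$, is its completion. Let $c\mathsf{Com}_0\subset c\mathsf{Com}$ be the full subcategory of reduced objects, and $c\mathsf{Com}^{\mathrm{fg}}_0$ that of the reduced $A^\bullet$ such that every $A^n$ is a finitely generated $\Bbbk$-algebra.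 Let $c\widehat{\mathsf{Alg}}_0$ be the category of reduced cosimplicial objects in complete local Noetherian $\Bbbk$-algebras with residue field $\Bbbk$. A cdga $C$ is *reduced* if $C^0=\Bbbk$; let $\mathsf{cdga}^{\mathrm{fg}}_0$ be the full subcategory of reduced cdgas with $\dim_\Bbbk C^i<\infty$ for all $i\ge 1$. Then: 1. $D^\ast$ maps $c\mathsf{Com}^{\mathrm{fg}}_0$ into $\mathsf{cdga}^{\mathrm{fg}}_0$ and $K^\bullet_{\mathrm{alg}}$ maps $\mathsf{cdga}^{\mathrm{fg}}_0$ into $c\mathsf{Com}^{\mathrm{fg}}_0$, and the adjunction $D^\ast\dashv K^\bullet_{\mathrm{alg}}$ restricts (with the same unit and counit) to an adjunction $D^\ast\colon c\mathsf{Com}^{\mathrm{fg}}_0\rightleftarrows \mathsf{cdga}^{\mathrm{fg}}_0\colon K^\bullet_{\mathrm{alg}}$. 2. If $A^\bullet\in c\mathsf{Com}_0$, then $D^\ast(A^\bullet)$ and $D^\ast(\widehat A^\bullet)$ are reduced cdgas. If moreover every ideal $\mathfrak m_A^n\subseteq A^n$ is finitely generated (in particular, if $A^\bullet\in c\mathsf{Com}^{\mathrm{fg}}_0$),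 then the canonical map $A^\bullet\to\widehat A^\bullet$ induces an isomorphism $D^\ast(\widehat A^\bullet)\cong D^\ast(A^\bullet)$, natural in $A^\bullet$. 3. The adjunction of (1) extends along the completion functor: completion maps $c\mathsf{Com}^{\mathrm{fg}}_0$ into $c\widehat{\mathsf{Alg}}_0$, $D^\ast$ maps $c\widehat{\mathsf{Alg}}_0$ into $\mathsf{cdga}^{\mathrm{fg}}_0$, $K^\bullet_{\mathrm{alg}}$ maps $\mathsf{cdga}^{\mathrm{fg}}_0$ into $c\widehat{\mathsf{Alg}}_0$, and $D^\ast\dashv K^\bullet_{\mathrm{alg}}$ restricts (with the same unit and counit) to an adjunction $D^\ast\colon c\widehat{\mathsf{Alg}}_0\rightleftarrows \mathsf{cdga}^{\mathrm{fg}}_0\colon K^\bullet_{\mathrm{alg}}$. There are natural isomorphisms $D^\ast(\widehat A^\bullet)\cong D^\ast(A^\bullet)$ for $A^\bullet\in c\mathsf{Com}^{\mathrm{fg}}_0$ and $\widehat{K^\bullet_{\mathrm{alg}}(C)}\cong K^\bullet_{\mathrm{alg}}(C)$ for $C\in\mathsf{cdga}^{\mathrm{fg}}_0$, both induced by the canonical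 map to the completion. -/

import Mathlib

open CategoryTheory TensorProduct

universe u

noncomputable section

namespace CosimplicialDK

/-! ### Commutative dg algebras -/

/-- A commutative differential graded algebra over `k`, cohomologically graded and concentrated in
non-negative degrees: the underlying algebra is the direct sum of the submodules `deg n`. -/
structure CDGA (k : Type u) [Field k] where
  carrier : Type u
  [ring : Ring carrier]
  [algebra : Algebra k carrier]
  deg : ℕ → Submodule k carrier
  [graded : GradedAlgebra deg]
  d : carrier →ₗ[k] carrier
  d_mem : ∀ (n : ℕ) (x : carrier), x ∈ deg n → d x ∈ deg (n + 1)
  d_d : ∀ x : carrier, d (d x) = 0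
  leibniz : ∀ (m : ℕ) (x y : carrier), x ∈ deg m → d (x * y) = d x * y + (-1 : k) ^ m • (x * d y)
  comm : ∀ (m n : ℕ) (x y : carrier), x ∈ deg m → y ∈ deg n →
    x * y = (-1 : k) ^ (m * n) • (y * x)

attribute [instance] CDGA.ring CDGA.algebra CDGA.graded

variable {k : Type u} [Field k]

/-- Morphisms of cdgas: unital algebra morphisms of degree zero that commute with `d`. -/
@[ext]
structure CDGA.Hom (C D : CDGA k) where
  toAlgHom : C.carrier →ₐ[k] D.carrier
  map_deg : ∀ (n : ℕ) (x : C.carrier), x ∈ C.deg n → toAlgHom x ∈ D.deg n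
  map_d : ∀ x : C.carrier, toAlgHom (C.d x) = D.d (toAlgHom x)

instance : Category (CDGA k) where
  Hom := CDGA.Hom
  id C := ⟨AlgHom.id k C.carrier, fun _ _ h => h, fun _ => rfl⟩
  comp f g := ⟨g.toAlgHom.comp f.toAlgHom, fun n x h => g.map_deg n _ (f.map_deg n x h),
    fun x => by simp [f.map_d, g.map_d]⟩

/-- The linear map that is multiplication by `(-1) ^ n` in degree `n`. -/
def CDGA.sign (C : CDGA k) : C.carrier →ₗ[k] C.carrier :=
  (DirectSum.toModule k ℕ C.carrier fun n => (-1 : k) ^ n • (C.deg n).subtype) ∘ₗ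
    (DirectSum.decomposeLinearEquiv C.deg).toLinearMap

lemma CDGA.sign_apply (C : CDGA k) {n : ℕ} {x : C.carrier} (hx : x ∈ C.deg n) :
    C.sign x = (-1 : k) ^ n • x := by
  simp only [CDGA.sign, LinearMap.comp_apply, LinearEquiv.coe_coe,
    DirectSum.decomposeLinearEquiv_apply, DirectSum.decompose_of_mem _ hx]
  rw [← DirectSum.lof_eq_of k, DirectSum.toModule_lof]
  simp

/-! ### The cosimplicial cdga `Λ` -/

/-- `Λⁿ = k[e₀, …, eₙ]`, the free graded commutative algebra on generators of degree `-1`. The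
piece of degree `-i` is the `i`-th exterior power. -/
abbrev Lam (k : Type u) [Field k] (n : SimplexCategory) : Type u :=
  ExteriorAlgebra k (Fin (n.len + 1) →₀ k)

/-- `lamDeg k n i` is the part of `Λⁿ` of cohomological degree `-i`. -/
abbrev lamDeg (k : Type u) [Field k] (n : SimplexCategory) (i : ℕ) : Submodule k (Lam k n) :=
  ⋀[k]^i (Fin (n.len + 1) →₀ k)

/-- The functional with value `1` on each of the generators. -/
def lamFunctional (k : Type u) [Field k] (n : SimplexCategory) :
    Module.Dual k (Fin (n.len + 1) →₀ k) :=
  Finsupp.linearCombination k fun _ => (1 : k)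

/-- The differential of `Λⁿ`: the derivation sending each generator to `1`. -/
def lamD (k : Type u) [Field k] (n : SimplexCategory) : Lam k n →ₗ[k] Lam k n :=
  CliffordAlgebra.contractLeft (Q := 0) (lamFunctional k n)

/-- The algebra morphism `Λᵐ → Λⁿ`, `eᵢ ↦ e_{α i}`. -/
def lamMap (k : Type u) [Field k] {m n : SimplexCategory} (α : m ⟶ n) : Lam k m →ₐ[k] Lam k n :=
  ExteriorAlgebra.map (Finsupp.lmapDomain k k α.toOrderHom)

section Lam

variable {n : SimplexCategory}

lemma involute_of_mem {i : ℕ} {a : Lam k n} (ha : a ∈ lamDeg k n i) :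
    CliffordAlgebra.involute a = (-1 : k) ^ i • a := by
  induction ha using Submodule.pow_induction_on_left' with
  | algebraMap r => simp
  | add x y i hx hy h1 h2 => simp [h1, h2]
  | mem_mul m hm i x hx h =>
    obtain ⟨v, rfl⟩ := hm
    rw [map_mul, h]
    have : CliffordAlgebra.involute (ExteriorAlgebra.ι k v) = - ExteriorAlgebra.ι k v :=
      CliffordAlgebra.involute_ι _
    rw [this, pow_succ]
    simp

lemma iota_mul (v : Fin (n.len + 1) →₀ k) (b : Lam k n) :
    ExteriorAlgebra.ι k v * b = CliffordAlgebra.involute b * ExteriorAlgebra.ι k v := by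
  induction b using CliffordAlgebra.left_induction with
  | algebraMap r => simp [Algebra.commutes]
  | add x y h1 h2 => simp [mul_add, add_mul, h1, h2]
  | ι_mul x w h =>
    have hs : ExteriorAlgebra.ι k v * ExteriorAlgebra.ι k w =
        - (ExteriorAlgebra.ι k w * ExteriorAlgebra.ι k v) :=
      eq_neg_of_add_eq_zero_left (ExteriorAlgebra.ι_add_mul_swap v w)
    rw [map_mul, CliffordAlgebra.involute_ι, mul_assoc, ← h, ← mul_assoc, ← mul_assoc]
    change ExteriorAlgebra.ι k v * ExteriorAlgebra.ι k w * x =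
      - ExteriorAlgebra.ι k w * ExteriorAlgebra.ι k v * x
    rw [hs, neg_mul (ExteriorAlgebra.ι k w)]

lemma lam_comm {i j : ℕ} {a b : Lam k n} (ha : a ∈ lamDeg k n i) (hb : b ∈ lamDeg k n j) :
    a * b = (-1 : k) ^ (i * j) • (b * a) := by
  induction ha using Submodule.pow_induction_on_left' with
  | algebraMap r => simp [Algebra.commutes]
  | add x y i hx hy h1 h2 => simp [add_mul, mul_add, h1, h2]
  | mem_mul m hm i x hx h =>
    obtain ⟨v, rfl⟩ := hm
    rw [mul_assoc, h, mul_smul_comm, ← mul_assoc, iota_mul, involute_of_mem hb,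
      smul_mul_assoc, smul_mul_assoc, smul_smul, mul_assoc, ← pow_add]
    congr 2
    rw [Nat.succ_eq_add_one, add_mul, one_mul]

lemma lamD_mul (a b : Lam k n) :
    lamD k n (a * b) = lamD k n a * b + CliffordAlgebra.involute a * lamD k n b := by
  unfold lamD
  induction a using CliffordAlgebra.left_induction with
  | algebraMap r => simp [CliffordAlgebra.contractLeft_algebraMap_mul]
  | add x y h1 h2 => simp only [add_mul, map_add, h1, h2]; abel
  | ι_mul x v h =>
    rw [mul_assoc, CliffordAlgebra.contractLeft_ι_mul, h, CliffordAlgebra.contractLeft_ι_mul,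
      map_mul, CliffordAlgebra.involute_ι]
    simp only [mul_add, sub_mul, smul_mul_assoc, neg_mul, mul_assoc]
    abel

lemma lamMap_lamD {m : SimplexCategory} (α : m ⟶ n) (a : Lam k m) :
    lamMap k α (lamD k m a) = lamD k n (lamMap k α a) := by
  unfold lamD
  induction a using CliffordAlgebra.left_induction with
  | algebraMap r => 
    rw [CliffordAlgebra.contractLeft_algebraMap, map_zero, AlgHom.commutes]
    exact (CliffordAlgebra.contractLeft_algebraMap (Q := 0) _ _).symm
  | add x y h1 h2 => simp only [map_add, h1, h2]
  | ι_mul x v h =>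
    have hv : lamMap k α (CliffordAlgebra.ι 0 v) =
        CliffordAlgebra.ι 0 (Finsupp.lmapDomain k k α.toOrderHom v) :=
      ExteriorAlgebra.map_apply_ι _ _
    have hf : lamFunctional k n (Finsupp.lmapDomain k k α.toOrderHom v) = lamFunctional k m v := by
      simp only [lamFunctional, Finsupp.lmapDomain_apply, Finsupp.linearCombination_mapDomain]
      rfl
    rw [CliffordAlgebra.contractLeft_ι_mul, map_sub, map_smul, map_mul, map_mul, hv, h,
      CliffordAlgebra.contractLeft_ι_mul, hf]

lemma lamMap_mem {m : SimplexCategory} (α : m ⟶ n) {i : ℕ} {a : Lam k m} (ha : a ∈ lamDeg k m i) :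
    lamMap k α a ∈ lamDeg k n i := by
  induction ha using Submodule.pow_induction_on_left' with
  | algebraMap r => rw [AlgHom.commutes]; exact SetLike.algebraMap_mem_graded (lamDeg k n) r
  | add x y i hx hy h1 h2 => rw [map_add]; exact add_mem h1 h2
  | mem_mul m hm i x hx h =>
    obtain ⟨v, rfl⟩ := hm
    have h2 : lamDeg k n i.succ = LinearMap.range (ExteriorAlgebra.ι k) * lamDeg k n i :=
      pow_succ' _ _
    rw [map_mul, h2]
    refine Submodule.mul_mem_mul ?_ h
    rw [lamMap, ExteriorAlgebra.map_apply_ι]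
    exact ⟨_, rfl⟩

lemma lamMap_id (a : Lam k n) : lamMap k (𝟙 n) a = a := by
  have : Finsupp.lmapDomain k k (SimplexCategory.Hom.toOrderHom (𝟙 n)) =
      (LinearMap.id : (Fin (n.len + 1) →₀ k) →ₗ[k] _) := by
    rw [← Finsupp.lmapDomain_id]; rfl
  rw [lamMap, this, ExteriorAlgebra.map_id]; rfl

lemma lamMap_comp {l m : SimplexCategory} (α : l ⟶ m) (β : m ⟶ n) (a : Lam k l) :
    lamMap k (α ≫ β) a = lamMap k β (lamMap k α a) := by
  rw [lamMap, lamMap, lamMap, ← AlgHom.comp_apply, ExteriorAlgebra.map_comp_map,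
    ← Finsupp.lmapDomain_comp]
  rfl

lemma lamD_mem_aux {i : ℕ} {x : Lam k n} (hx : x ∈ lamDeg k n i) :
    (i = 0 → lamD k n x = 0) ∧ ∀ j, i = j + 1 → lamD k n x ∈ lamDeg k n j := by
  induction hx using Submodule.pow_induction_on_left' with
  | algebraMap r =>
    exact ⟨fun _ => CliffordAlgebra.contractLeft_algebraMap (Q := 0) _ _, fun j h => by omega⟩
  | add x y i hx hy h1 h2 =>
    exact ⟨fun h => by rw [map_add, h1.1 h, h2.1 h, add_zero],
      fun j h => by rw [map_add]; exact add_mem (h1.2 j h) (h2.2 j h)⟩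
  | mem_mul m hm i x hx h =>
    obtain ⟨v, rfl⟩ := hm
    refine ⟨fun h => by omega, fun j hj => ?_⟩
    obtain rfl : i = j := by omega
    have h2 : lamD k n (ExteriorAlgebra.ι k v * x) =
        lamFunctional k n v • x - ExteriorAlgebra.ι k v * lamD k n x :=
      CliffordAlgebra.contractLeft_ι_mul (Q := 0) (d := lamFunctional k n) v x
    rw [h2]
    refine sub_mem (Submodule.smul_mem _ _ hx) ?_
    cases i with
    | zero => rw [h.1 rfl, mul_zero]; exact zero_mem _
    | succ i =>
      have h3 : lamDeg k n (i + 1) = LinearMap.range (ExteriorAlgebra.ι k) * lamDeg k n i :=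
        pow_succ' _ _
      rw [h3]
      exact Submodule.mul_mem_mul ⟨v, rfl⟩ (h.2 i rfl)

lemma lamD_mem {i : ℕ} {x : Lam k n} (hx : x ∈ lamDeg k n (i + 1)) :
    lamD k n x ∈ lamDeg k n i :=
  (lamD_mem_aux hx).2 i rfl

lemma lamD_zero {x : Lam k n} (hx : x ∈ lamDeg k n 0) : lamD k n x = 0 :=
  (lamD_mem_aux hx).1 rfl

end Lam

/-! ### The functor `K` -/

section K

open scoped TensorProduct

variable (C : CDGA k) (n : SimplexCategory)

/-- The tensor product `C ⊗ Λⁿ` of graded algebras, with the Koszul sign in the multiplication: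
`(a ⊗ x) (b ⊗ y) = (-1) ^ (|x| |b|) (a b ⊗ x y)`. -/
abbrev TensorLam : Type u := C.deg ᵍ⊗[k] (lamDeg k n)

/-- The total differential `d (a ⊗ x) = d a ⊗ x + (-1) ^ |a| a ⊗ d x`. -/
def tensorD : TensorLam C n →ₗ[k] TensorLam C n :=
  (GradedTensorProduct.of k C.deg (lamDeg k n)).toLinearMap ∘ₗ
    (TensorProduct.map C.d LinearMap.id + TensorProduct.map C.sign (lamD k n)) ∘ₗ
      (GradedTensorProduct.of k C.deg (lamDeg k n)).symm.toLinearMap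

/-- The element `a ⊗ x` of `C ⊗ Λⁿ`. -/
def tm (a : C.carrier) (x : Lam k n) : TensorLam C n :=
  GradedTensorProduct.of k C.deg (lamDeg k n) (a ⊗ₜ[k] x)

/-- The part of `C ⊗ Λⁿ` of total degree zero. -/
def tensorZero : Submodule k (TensorLam C n) :=
  Submodule.span k {t | ∃ (i : ℕ) (a : C.carrier) (x : Lam k n),
    a ∈ C.deg i ∧ x ∈ lamDeg k n i ∧ t = tm C n a x}

variable {C n}

lemma add_tm (a b : C.carrier) (x : Lam k n) : tm C n (a + b) x = tm C n a x + tm C n b x := by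
  simp [tm, TensorProduct.add_tmul]

lemma tm_add (a : C.carrier) (x y : Lam k n) : tm C n a (x + y) = tm C n a x + tm C n a y := by
  simp [tm, TensorProduct.tmul_add]

lemma smul_tm (r : k) (a : C.carrier) (x : Lam k n) : tm C n (r • a) x = r • tm C n a x := by
  rw [tm, tm, ← TensorProduct.smul_tmul', map_smul]

lemma tm_smul (r : k) (a : C.carrier) (x : Lam k n) : tm C n a (r • x) = r • tm C n a x := by
  rw [tm, tm, TensorProduct.tmul_smul, map_smul]

lemma tm_zero (a : C.carrier) : tm C n a 0 = 0 := by
  rw [tm, TensorProduct.tmul_zero, map_zero]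

lemma tm_mul_tm {j i : ℕ} (a : C.carrier) {x : Lam k n} (hx : x ∈ lamDeg k n j)
    {b : C.carrier} (hb : b ∈ C.deg i) (y : Lam k n) :
    (tm C n a x * tm C n b y) =
      (-1 : k) ^ (j * i) • tm C n (a * b) (x * y) := by
  have h := GradedTensorProduct.tmul_coe_mul_coe_tmul C.deg (lamDeg k n) a ⟨x, hx⟩ ⟨b, hb⟩ y
  refine h.trans ?_
  change (-1 : ℤˣ) ^ (j * i) • tm C n (a * b) (x * y) = _
  rcases Nat.even_or_odd (j * i) with he | ho
  · rw [he.neg_one_pow, he.neg_one_pow, one_smul, one_smul]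
  · rw [ho.neg_one_pow, ho.neg_one_pow, neg_smul, one_smul, Units.neg_smul, one_smul]

lemma tensorD_tm {i : ℕ} {a : C.carrier} (ha : a ∈ C.deg i) (x : Lam k n) :
    tensorD C n (tm C n a x) = tm C n (C.d a) x + (-1 : k) ^ i • (tm C n a (lamD k n x)) := by
  have : tensorD C n (tm C n a x) = tm C n (C.d a) x + tm C n (C.sign a) (lamD k n x) := rfl
  rw [this, C.sign_apply ha, smul_tm]

lemma tensorZero_one : (1 : TensorLam C n) ∈ tensorZero C n :=
  Submodule.subset_span ⟨0, 1, 1, SetLike.one_mem_graded _, SetLike.one_mem_graded _, rfl⟩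

lemma tensorZero_mul {s t : TensorLam C n} (hs : s ∈ tensorZero C n) (ht : t ∈ tensorZero C n) :
    s * t ∈ tensorZero C n := by
  induction hs, ht using Submodule.span_induction₂ with
  | mem_mem s t hs ht =>
    obtain ⟨i, a, x, ha, hx, rfl⟩ := hs
    obtain ⟨j, b, y, hb, hy, rfl⟩ := ht
    rw [tm_mul_tm a hx hb y]
    exact Submodule.smul_mem _ _ (Submodule.subset_span
      ⟨i + j, _, _, SetLike.mul_mem_graded ha hb, SetLike.mul_mem_graded hx hy, rfl⟩)
  | zero_left y hy => simp
  | zero_right x hx => simp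
  | add_left x y z _ _ _ h1 h2 => rw [add_mul]; exact add_mem h1 h2
  | add_right x y z _ _ _ h1 h2 => rw [mul_add]; exact add_mem h1 h2
  | smul_left r x y _ _ h => rw [smul_mul_assoc]; exact Submodule.smul_mem _ _ h
  | smul_right r x y _ _ h => rw [mul_smul_comm]; exact Submodule.smul_mem _ _ h

lemma tensorZero_comm {s t : TensorLam C n} (hs : s ∈ tensorZero C n) (ht : t ∈ tensorZero C n) :
    s * t = t * s := by
  induction hs, ht using Submodule.span_induction₂ with
  | mem_mem s t hs ht =>
    obtain ⟨i, a, x, ha, hx, rfl⟩ := hs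
    obtain ⟨j, b, y, hb, hy, rfl⟩ := ht
    rw [tm_mul_tm a hx hb y, tm_mul_tm b hy ha x, C.comm i j a b ha hb, lam_comm hx hy]
    simp only [tm_smul, smul_tm, smul_smul]
    congr 1
    rw [mul_comm j i, ← pow_add, ← pow_add]
    rcases Nat.even_or_odd (i * j) with he | ho
    · simp [pow_add, he.neg_one_pow]
    · simp [pow_add, ho.neg_one_pow]
  | zero_left y hy => simp
  | zero_right x hx => simp
  | add_left x y z _ _ _ h1 h2 => rw [add_mul, mul_add, h1, h2]
  | add_right x y z _ _ _ h1 h2 => rw [add_mul, mul_add, h1, h2]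
  | smul_left r x y _ _ h => rw [smul_mul_assoc, mul_smul_comm, h]
  | smul_right r x y _ _ h => rw [smul_mul_assoc, mul_smul_comm, h]

lemma tensorD_mul {s t : TensorLam C n} (hs : s ∈ tensorZero C n) (ht : t ∈ tensorZero C n) :
    tensorD C n (s * t) = tensorD C n s * t + s * tensorD C n t := by
  induction hs, ht using Submodule.span_induction₂ with
  | mem_mem s t hs ht =>
    obtain ⟨i, a, x, ha, hx, rfl⟩ := hs
    obtain ⟨j, b, y, hb, hy, rfl⟩ := ht
    rw [tm_mul_tm a hx hb y, map_smul, tensorD_tm (SetLike.mul_mem_graded ha hb),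
      tensorD_tm ha, tensorD_tm hb, C.leibniz i a b ha, lamD_mul, involute_of_mem hx,
      add_mul, mul_add, smul_mul_assoc, mul_smul_comm, tm_mul_tm _ hx hb y,
      tm_mul_tm a hx (C.d_mem j b hb) y, tm_mul_tm a hx hb (lamD k n y)]
    cases i with
    | zero =>
      rw [lamD_zero hx]
      simp only [tm_zero, add_tm, zero_mul, smul_zero, zero_add, pow_zero, one_smul]
      module
    | succ i =>
      rw [smul_mul_assoc, tm_mul_tm a (lamD_mem hx) hb y]
      simp only [add_tm, tm_add, smul_tm, tm_smul, smul_add, smul_smul]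
      rcases neg_one_pow_eq_or k j with hj | hj <;> rcases neg_one_pow_eq_or k i with hi | hi <;>
      rcases neg_one_pow_eq_or k (i * j) with hij | hij <;>
      simp only [pow_add, add_mul, mul_add, mul_one, one_mul, pow_one, hi, hj, hij] <;> module
  | zero_left y hy => simp
  | zero_right x hx => simp
  | add_left x y z _ _ _ h1 h2 => simp only [add_mul, map_add, h1, h2]; abel
  | add_right x y z _ _ _ h1 h2 => simp only [mul_add, map_add, h1, h2]; abel
  | smul_left r x y _ _ h => simp only [smul_mul_assoc, map_smul, h, smul_add]
  | smul_right r x y _ _ h => simp only [mul_smul_comm, map_smul, h, smul_add]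

variable (C n)

/-- `Kⁿ(C) = Z⁰(C ⊗ Λⁿ)`: the cocycles of total degree zero, as a subalgebra of `C ⊗ Λⁿ`. -/
def kSubalgebra : Subalgebra k (TensorLam C n) where
  carrier := {t | t ∈ tensorZero C n ∧ tensorD C n t = 0}
  mul_mem' hs ht := ⟨tensorZero_mul hs.1 ht.1, by rw [tensorD_mul hs.1 ht.1, hs.2, ht.2]; simp⟩
  add_mem' hs ht := ⟨add_mem hs.1 ht.1, by rw [map_add, hs.2, ht.2, add_zero]⟩
  algebraMap_mem' r := by
    rw [Algebra.algebraMap_eq_smul_one]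
    refine ⟨Submodule.smul_mem _ _ tensorZero_one, ?_⟩
    have h := tensorD_mul (C := C) (n := n) tensorZero_one tensorZero_one
    rw [mul_one, mul_one, one_mul] at h
    rw [map_smul, left_eq_add.mp h, smul_zero]

instance : CommRing (kSubalgebra C n) where
  mul_comm s t := Subtype.ext (tensorZero_comm s.2.1 t.2.1)

variable {C n}

/-- The linear map `f ⊗ α : C ⊗ Λᵐ → D ⊗ Λⁿ`. -/
def tensorMap {C D : CDGA k} (f : C ⟶ D) {m n : SimplexCategory} (α : m ⟶ n) :
    TensorLam C m →ₗ[k] TensorLam D n :=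
  (GradedTensorProduct.of k D.deg (lamDeg k n)).toLinearMap ∘ₗ
    TensorProduct.map (CDGA.Hom.toAlgHom f).toLinearMap (lamMap k α).toLinearMap ∘ₗ
      (GradedTensorProduct.of k C.deg (lamDeg k m)).symm.toLinearMap

section Map

variable {C D : CDGA k} (f : C ⟶ D) {m n : SimplexCategory} (α : m ⟶ n)

lemma tensorMap_tm (a : C.carrier) (x : Lam k m) :
    tensorMap f α (tm C m a x) = tm D n (CDGA.Hom.toAlgHom f a) (lamMap k α x) := rfl

lemma tensorMap_mem {t : TensorLam C m} (ht : t ∈ tensorZero C m) :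
    tensorMap f α t ∈ tensorZero D n := by
  induction ht using Submodule.span_induction with
  | mem t ht =>
    obtain ⟨i, a, x, ha, hx, rfl⟩ := ht
    exact Submodule.subset_span ⟨i, _, _, f.map_deg i a ha, lamMap_mem α hx, rfl⟩
  | zero => simp
  | add x y _ _ h1 h2 => rw [map_add]; exact add_mem h1 h2
  | smul r x _ h => rw [map_smul]; exact Submodule.smul_mem _ _ h

lemma tensorMap_tensorD {t : TensorLam C m} (ht : t ∈ tensorZero C m) :
    tensorMap f α (tensorD C m t) = tensorD D n (tensorMap f α t) := by
  induction ht using Submodule.span_induction with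
  | mem t ht =>
    obtain ⟨i, a, x, ha, hx, rfl⟩ := ht
    rw [tensorMap_tm, tensorD_tm ha, tensorD_tm (f.map_deg i a ha), map_add, map_smul,
      tensorMap_tm, tensorMap_tm, f.map_d, lamMap_lamD]
  | zero => simp
  | add x y _ _ h1 h2 => simp only [map_add, h1, h2]
  | smul r x _ h => simp only [map_smul, h]

lemma tensorMap_mul {s t : TensorLam C m} (hs : s ∈ tensorZero C m) (ht : t ∈ tensorZero C m) :
    tensorMap f α (s * t) = tensorMap f α s * tensorMap f α t := by
  induction hs, ht using Submodule.span_induction₂ with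
  | mem_mem s t hs ht =>
    obtain ⟨i, a, x, ha, hx, rfl⟩ := hs
    obtain ⟨j, b, y, hb, hy, rfl⟩ := ht
    rw [tm_mul_tm a hx hb y, map_smul, tensorMap_tm, tensorMap_tm, tensorMap_tm,
      tm_mul_tm _ (lamMap_mem α hx) (f.map_deg j b hb), map_mul, map_mul]
  | zero_left y hy => simp
  | zero_right x hx => simp
  | add_left x y z _ _ _ h1 h2 => simp only [add_mul, map_add, h1, h2]
  | add_right x y z _ _ _ h1 h2 => simp only [mul_add, map_add, h1, h2]
  | smul_left r x y _ _ h => simp only [smul_mul_assoc, map_smul, h]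
  | smul_right r x y _ _ h => simp only [mul_smul_comm, map_smul, h]

lemma tensorMap_one : tensorMap f α (1 : TensorLam C m) = 1 := by
  change tensorMap f α (tm C m 1 1) = 1
  rw [tensorMap_tm, map_one, map_one]
  rfl

/-- The algebra morphism `Kᵐ(C) → Kⁿ(D)` induced by a morphism of cdgas and a map `[m] → [n]`. -/
def kMap : kSubalgebra C m →ₐ[k] kSubalgebra D n :=
  AlgHom.ofLinearMap
    ((tensorMap f α).restrict (p := Subalgebra.toSubmodule (kSubalgebra C m))
      (q := Subalgebra.toSubmodule (kSubalgebra D n))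
      fun t ht => ⟨tensorMap_mem f α ht.1, by rw [← tensorMap_tensorD f α ht.1, ht.2, map_zero]⟩)
    (Subtype.ext (tensorMap_one f α))
    fun s t => Subtype.ext (tensorMap_mul f α s.2.1 t.2.1)

lemma kMap_coe (t : kSubalgebra C m) : (kMap f α t : TensorLam D n) = tensorMap f α t := rfl

end Map

lemma tensorMap_id {C : CDGA k} {n : SimplexCategory} (t : TensorLam C n) :
    tensorMap (𝟙 C) (𝟙 n) t = t := by
  have h : (lamMap k (𝟙 n)).toLinearMap = LinearMap.id := LinearMap.ext lamMap_id
  have h' : (CDGA.Hom.toAlgHom (𝟙 C)).toLinearMap = LinearMap.id := rfl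
  rw [tensorMap, h, h', TensorProduct.map_id]
  rfl

lemma tensorMap_comp {C D E : CDGA k} (f : C ⟶ D) (g : D ⟶ E) {l m n : SimplexCategory}
    (α : l ⟶ m) (β : m ⟶ n) (t : TensorLam C l) :
    tensorMap (f ≫ g) (α ≫ β) t = tensorMap g β (tensorMap f α t) := by
  have h : (lamMap k (α ≫ β)).toLinearMap = (lamMap k β).toLinearMap ∘ₗ (lamMap k α).toLinearMap :=
    LinearMap.ext (lamMap_comp α β)
  have h' : (CDGA.Hom.toAlgHom (f ≫ g)).toLinearMap =
      (CDGA.Hom.toAlgHom g).toLinearMap ∘ₗ (CDGA.Hom.toAlgHom f).toLinearMap := rfl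
  rw [tensorMap, h, h', TensorProduct.map_comp]
  rfl

end K

/-- Cosimplicial commutative `k`-algebras. -/
abbrev CosimpAlg (k : Type u) [Field k] : Type (u + 1) := SimplexCategory ⥤ CommAlgCat.{u} k

/-- The functor `K_alg` from cdgas to cosimplicial commutative algebras, `Kⁿ(C) = Z⁰(C ⊗ Λⁿ)`. -/
def Kalg (k : Type u) [Field k] : CDGA k ⥤ CosimpAlg k where
  obj C :=
    { obj := fun n => CommAlgCat.of k (kSubalgebra C n)
      map := fun α => CommAlgCat.ofHom (kMap (𝟙 C) α)
      map_id := fun n => by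
        ext t
        exact tensorMap_id _
      map_comp := fun α β => by
        ext t
        have := tensorMap_comp (𝟙 C) (𝟙 C) α β (t : TensorLam C _)
        rw [Category.comp_id] at this
        exact this }
  map f :=
    { app := fun n => CommAlgCat.ofHom (kMap f (𝟙 n))
      naturality := fun m n α => by
        ext t
        have h1 := tensorMap_comp (𝟙 _) f α (𝟙 n) (t : TensorLam _ _)
        have h2 := tensorMap_comp f (𝟙 _) (𝟙 m) α (t : TensorLam _ _)
        rw [Category.comp_id, Category.id_comp] at h1 h2
        exact h1.symm.trans h2 }
  map_id C := by
    ext n t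
    exact tensorMap_id _
  map_comp f g := by
    ext n t
    have := tensorMap_comp f g (𝟙 n) (𝟙 n) (t : TensorLam _ n)
    rw [Category.comp_id] at this
    exact this

/-! ### Completion -/

section Completion

/-- The ideal `𝔪ⁿ ⊆ Aⁿ`: the kernel of the map `Aⁿ → A⁰` induced by the unique map `[n] → [0]`.
If `A⁰ = k` this is the augmentation ideal of `Aⁿ`. -/
def augIdeal (A : CosimpAlg k) (n : SimplexCategory) : Ideal (A.obj n) :=
  RingHom.ker (A.map (SimplexCategory.isTerminalZero.from n)).hom

lemma augIdeal_map (A : CosimpAlg k) {m n : SimplexCategory} (α : m ⟶ n) :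
    augIdeal A m ≤ (augIdeal A n).comap (A.map α).hom := by
  intro x hx
  change (A.map (SimplexCategory.isTerminalZero.from n)).hom ((A.map α).hom x) = 0
  rw [← AlgHom.comp_apply, ← CommAlgCat.hom_comp, ← A.map_comp,
    SimplexCategory.isTerminalZero.hom_ext (α ≫ _) (SimplexCategory.isTerminalZero.from m)]
  exact hx

lemma augIdeal_app {A B : CosimpAlg k} (f : A ⟶ B) (n : SimplexCategory) :
    augIdeal A n ≤ (augIdeal B n).comap (f.app n).hom := by
  intro x hx
  change (B.map (SimplexCategory.isTerminalZero.from n)).hom ((f.app n).hom x) = 0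
  rw [← AlgHom.comp_apply, ← CommAlgCat.hom_comp, ← f.naturality, CommAlgCat.hom_comp,
    AlgHom.comp_apply]
  have hx' : (A.map (SimplexCategory.isTerminalZero.from n)).hom x = 0 := hx
  rw [hx', map_zero]

lemma completionMap_compat {R S : Type u} [CommRing R] [CommRing S] [Algebra k R] [Algebra k S]
    (I : Ideal R) (J : Ideal S) (f : R →ₐ[k] S) (h : I ≤ J.comap f) {a b : ℕ} (hab : a ≤ b) :
    (Ideal.Quotient.factorₐ k (Ideal.pow_le_pow_right hab)).comp
      ((Ideal.quotientMapₐ (J ^ b) f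
        ((Ideal.pow_right_mono h b).trans (Ideal.le_comap_pow f b))).comp
          ((AdicCompletion.evalₐ I b).restrictScalars k)) =
      (Ideal.quotientMapₐ (J ^ a) f
        ((Ideal.pow_right_mono h a).trans (Ideal.le_comap_pow f a))).comp
          ((AdicCompletion.evalₐ I a).restrictScalars k) := by
  ext x
  obtain ⟨c, rfl⟩ := AdicCompletion.mk_surjective I R x
  simp only [AlgHom.comp_apply, AlgHom.restrictScalars_apply, AdicCompletion.evalₐ_mk,
    Ideal.quotient_map_mkₐ]
  change Ideal.Quotient.mk (J ^ a) (f (c.val b)) = Ideal.Quotient.mk (J ^ a) (f (c.val a))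
  have hc := AdicCompletion.Ideal.mk_eq_mk I hab c
  rw [Ideal.Quotient.eq] at hc ⊢
  rw [← map_sub]
  exact ((Ideal.pow_right_mono h a).trans (Ideal.le_comap_pow f a)) hc

/-- The map induced on adic completions by an algebra morphism mapping `I` into `J`. -/
def completionMap {R S : Type u} [CommRing R] [CommRing S] [Algebra k R] [Algebra k S]
    (I : Ideal R) (J : Ideal S) (f : R →ₐ[k] S) (h : I ≤ J.comap f) :
    AdicCompletion I R →ₐ[k] AdicCompletion J S :=
  AdicCompletion.liftAlgHom J
    (fun i => (Ideal.quotientMapₐ (J ^ i) f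
      ((Ideal.pow_right_mono h i).trans (Ideal.le_comap_pow f i))).comp
        ((AdicCompletion.evalₐ I i).restrictScalars k))
    (completionMap_compat I J f h)

section

variable {R S T : Type u} [CommRing R] [CommRing S] [CommRing T] [Algebra k R] [Algebra k S]
  [Algebra k T] {I : Ideal R} {J : Ideal S} {L : Ideal T}

lemma eval_completionMap (f : R →ₐ[k] S) (h : I ≤ J.comap f) (i : ℕ)
    (c : AdicCompletion.AdicCauchySequence I R) :
    AdicCompletion.evalₐ J i (completionMap I J f h (AdicCompletion.mk I R c)) =
      Ideal.Quotient.mk (J ^ i) (f (c.val i)) := by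
  refine (AdicCompletion.evalₐ_liftAlgHom J _ (completionMap_compat I J f h) i _).trans ?_
  rw [AlgHom.comp_apply, AlgHom.restrictScalars_apply, AdicCompletion.evalₐ_mk]
  rfl

lemma eval_completionMap' (f : R →ₐ[k] S) (h : I ≤ J.comap f) (i : ℕ) (x : AdicCompletion I R) :
    AdicCompletion.evalₐ J i (completionMap I J f h x) =
      Ideal.quotientMapₐ (J ^ i) f ((Ideal.pow_right_mono h i).trans (Ideal.le_comap_pow f i))
        (AdicCompletion.evalₐ I i x) := by
  exact AdicCompletion.evalₐ_liftAlgHom J _ (completionMap_compat I J f h) i _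

lemma completionMap_id (h : I ≤ I.comap (AlgHom.id k R)) (x : AdicCompletion I R) :
    completionMap I I (AlgHom.id k R) h x = x := by
  refine AdicCompletion.ext_evalₐ fun i => ?_
  obtain ⟨c, rfl⟩ := AdicCompletion.mk_surjective I R x
  rw [eval_completionMap, AdicCompletion.evalₐ_mk]
  rfl

lemma completionMap_comp (f : R →ₐ[k] S) (g : S →ₐ[k] T) (hf : I ≤ J.comap f) (hg : J ≤ L.comap g)
    (hgf : I ≤ L.comap (g.comp f)) (x : AdicCompletion I R) :
    completionMap I L (g.comp f) hgf x = completionMap J L g hg (completionMap I J f hf x) := by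
  refine AdicCompletion.ext_evalₐ fun i => ?_
  obtain ⟨c, rfl⟩ := AdicCompletion.mk_surjective I R x
  rw [eval_completionMap, eval_completionMap', eval_completionMap]
  rfl

lemma completionMap_of (f : R →ₐ[k] S) (h : I ≤ J.comap f) (x : R) :
    completionMap I J f h (algebraMap R (AdicCompletion I R) x) =
      algebraMap S (AdicCompletion J S) (f x) := by
  refine AdicCompletion.ext_evalₐ fun i => ?_
  rw [eval_completionMap', AlgHom.commutes, AlgHom.commutes]
  rfl

end

/-- The functor sending `A` to its completion `Â`, with `Âⁿ = lim_i Aⁿ / (𝔪ⁿ)^i`. -/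
def completion (k : Type u) [Field k] : CosimpAlg k ⥤ CosimpAlg k where
  obj A :=
    { obj := fun n => CommAlgCat.of k (AdicCompletion (augIdeal A n) (A.obj n))
      map := fun {m n} α => CommAlgCat.ofHom (completionMap _ _ (A.map α).hom (augIdeal_map A α))
      map_id := fun n => by
        refine CommAlgCat.hom_ext (AlgHom.ext fun x => ?_)
        have := completionMap_id (augIdeal_map A (𝟙 n) |>.trans (by rw [A.map_id]; rfl)) x
        refine Eq.trans ?_ this
        simp
      map_comp := fun {l m n} α β => by
        refine CommAlgCat.hom_ext (AlgHom.ext fun x => ?_)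
        have := completionMap_comp (A.map α).hom (A.map β).hom (augIdeal_map A α)
          (augIdeal_map A β) ((augIdeal_map A (α ≫ β)).trans (by rw [A.map_comp]; rfl)) x
        refine Eq.trans ?_ this
        simp }
  map {A B} f :=
    { app := fun n => CommAlgCat.ofHom (completionMap _ _ (f.app n).hom (augIdeal_app f n))
      naturality := fun m n α => by
        refine CommAlgCat.hom_ext (AlgHom.ext fun x => ?_)
        have h : (augIdeal A m) ≤ (augIdeal B n).comap (A.map α ≫ f.app n).hom :=
          (augIdeal_map A α).trans (Ideal.comap_mono (augIdeal_app f n))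
        have h1 := completionMap_comp (A.map α).hom (f.app n).hom (augIdeal_map A α)
          (augIdeal_app f n) h x
        have h2 := completionMap_comp (f.app m).hom (B.map α).hom (augIdeal_app f m)
          (augIdeal_map B α) (by rw [← CommAlgCat.hom_comp, ← f.naturality]; exact h) x
        refine h1.symm.trans (Eq.trans ?_ h2)
        simp only [← CommAlgCat.hom_comp, f.naturality] }
  map_id A := by
    refine NatTrans.ext (funext fun n => CommAlgCat.hom_ext (AlgHom.ext fun x => ?_))
    exact completionMap_id (augIdeal_app (𝟙 A) n) x
  map_comp {A B C} f g := by
    refine NatTrans.ext (funext fun n => CommAlgCat.hom_ext (AlgHom.ext fun x => ?_))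
    exact completionMap_comp (f.app n).hom (g.app n).hom (augIdeal_app f n) (augIdeal_app g n)
      (augIdeal_app (f ≫ g) n) x

/-- The canonical natural morphism `A ⟶ Â`. -/
def toCompletion (k : Type u) [Field k] : 𝟭 (CosimpAlg k) ⟶ completion k where
  app A :=
    { app := fun n => CommAlgCat.ofHom
        (IsScalarTower.toAlgHom k (A.obj n) (AdicCompletion (augIdeal A n) (A.obj n)))
      naturality := fun m n α => by
        ext x
        exact (completionMap_of (A.map α).hom (augIdeal_map A α) x).symm }
  naturality A B f := by
    ext n x
    exact (completionMap_of (f.app n).hom (augIdeal_app f n) x).symm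

end Completion

/-! ### Reduced and finitely generated objects -/

section Properties

/-- A cosimplicial algebra is reduced if `A⁰ = k`. -/
def CosimpAlg.IsReduced (A : CosimpAlg k) : Prop :=
  Function.Bijective (algebraMap k (A.obj (SimplexCategory.mk 0)))

/-- Reduced cosimplicial algebras such that each `Aⁿ` is a finitely generated `k`-algebra. -/
def reducedFG (k : Type u) [Field k] : ObjectProperty (CosimpAlg k) := fun A =>
  A.IsReduced ∧ ∀ n, Algebra.FiniteType k (A.obj n)

/-- Reduced cosimplicial algebras such that each augmentation ideal `𝔪ⁿ ⊆ Aⁿ` is finitely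
generated. -/
def reducedFGIdeal (k : Type u) [Field k] : ObjectProperty (CosimpAlg k) := fun A =>
  A.IsReduced ∧ ∀ n, (augIdeal A n).FG

/-- A complete local Noetherian `k`-algebra with residue field `k`. -/
structure IsCompleteLocalNoetherian (k : Type u) [Field k] (R : Type u) [CommRing R]
    [Algebra k R] : Prop where
  isLocalRing : IsLocalRing R
  isNoetherianRing : IsNoetherianRing R
  isAdicComplete : IsAdicComplete (IsLocalRing.maximalIdeal R) R
  bijective : Function.Bijective (algebraMap k (IsLocalRing.ResidueField R))

/-- Reduced cosimplicial objects in the category of complete local Noetherian `k`-algebras with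
residue field `k`. Every `k`-algebra morphism between such algebras is local, so that they form a
full subcategory of the cosimplicial algebras. -/
def reducedComplete (k : Type u) [Field k] : ObjectProperty (CosimpAlg k) := fun A =>
  A.IsReduced ∧ ∀ n, IsCompleteLocalNoetherian k (A.obj n)

/-- A cdga is reduced if `C⁰ = k`. -/
def CDGA.IsReduced (C : CDGA k) : Prop :=
  Function.Injective (algebraMap k C.carrier) ∧
    ∀ x ∈ C.deg 0, ∃ r : k, algebraMap k C.carrier r = x

/-- Reduced cdgas that are finite-dimensional in each positive degree. -/
def reducedFGCDGA (k : Type u) [Field k] : ObjectProperty (CDGA k) := fun C =>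
  C.IsReduced ∧ ∀ i : ℕ, 1 ≤ i → FiniteDimensional k (C.deg i)

/-- The restriction of a functor to full subcategories. -/
abbrev restrict {X Y : Type*} [Category X] [Category Y] {P : ObjectProperty X}
    {Q : ObjectProperty Y} (F : X ⥤ Y) (hF : ∀ A, P A → Q (F.obj A)) :
    P.FullSubcategory ⥤ Q.FullSubcategory :=
  Q.lift (P.ι ⋙ F) fun A => hF A.obj A.property

end Properties

end CosimplicialDK

end

open CosimplicialDK

noncomputable section

namespace CosimplicialDK

variable {k : Type u} [Field k]

/-! ### Iterated contractions on `Λ` -/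

/-! The whole proof works with coefficients of an element `t` of `C ⊗ Λⁿ`. Contracting the exterior
factor with a list of `p` functionals and taking the scalar part gives an element of `C`, of degree
`p` if `t` has total degree zero. In characteristic zero the Euler identity reconstructs `t` from
finitely many of these coefficients (`exists_tensor_expansion`).

Existence of a left adjoint: let `D(A)` be the span of all coefficients of elements of `A`, inside
the product of all cdgas `C` equipped with a morphism from `A` to `K(C)`. It is closed under `d`,
because the cocycle condition makes the differential of a coefficient, up to sign, a longer
coefficient (`d_coeff`). It is closed under products, because the product of coefficients of `a` in
`Aⁿ` and `b` in `Aᵐ` is a coefficient of the product of `a` and `b` in the algebra of the join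
(`coeff_join`). The expansion of an element in its coefficients supplies the unit. By uniqueness of
adjoints, for any left adjoint `D` the degree `p` part of `D(A)` is spanned by coefficients of
length `p` (`deg_le_span_coeff`).

Finiteness: when `A⁰ = k`, coefficients of length zero are scalars, which gives reducedness. A
coefficient of length `p` along generators involves at most `p` vertices, and these can be separated
from the rest by a map to `[2p]`, so `A` in cosimplicial degree `2p` produces everything in degree
`p` (`coeff_coordDual_eq`). Such a coefficient kills `𝔪^(p+1)`, and the quotient by that power is
finite-dimensional when `𝔪` is finitely generated.

Completion: filtering by `C`-degree shows that the augmentation ideals of `K(C)` are nilpotent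
(`augIdeal_Kalg_pow`), so `K(C)` is already complete. Hence, when the ideals `𝔪ⁿ` are finitely
generated, morphisms to `K(C)` from `A` and from its completion agree
(`toCompletion_comp_bijective`), and the Yoneda lemma gives the invariance of `D`. The completion is
Noetherian because it is a quotient of a power series ring. -/

/-- Linear functionals on the space of generators of `Λⁿ`. -/
abbrev LamDual (k : Type u) [Field k] (n : SimplexCategory) : Type u :=
  Module.Dual k (Fin (n.len + 1) →₀ k)

/-- The contraction with a functional. -/
def contr {n : SimplexCategory} (f : LamDual k n) : Lam k n →ₗ[k] Lam k n :=
  CliffordAlgebra.contractLeft (Q := 0) f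

/-- The functional on `Λⁿ` which contracts successively with the members of a list and then takes
the scalar part. -/
def iterContr {n : SimplexCategory} : List (LamDual k n) → (Lam k n →ₗ[k] k)
  | [] => (ExteriorAlgebra.algebraMapInv).toLinearMap
  | f :: fs => iterContr fs ∘ₗ contr f

section Lam

variable {n : SimplexCategory}

lemma iterContr_nil (x : Lam k n) : iterContr [] x = ExteriorAlgebra.algebraMapInv x := rfl

lemma iterContr_cons (f : LamDual k n) (fs : List (LamDual k n)) (x : Lam k n) :
    iterContr (f :: fs) x = iterContr fs (contr f x) := rfl

lemma contr_algebraMap (f : LamDual k n) (r : k) : contr f (algebraMap k (Lam k n) r) = 0 :=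
  CliffordAlgebra.contractLeft_algebraMap (Q := 0) _ _

lemma contr_iota_mul (f : LamDual k n) (v : Fin (n.len + 1) →₀ k) (x : Lam k n) :
    contr f (ExteriorAlgebra.ι k v * x) = f v • x - ExteriorAlgebra.ι k v * contr f x :=
  CliffordAlgebra.contractLeft_ι_mul (Q := 0) (d := f) v x

lemma contr_mul (f : LamDual k n) (a b : Lam k n) :
    contr f (a * b) = contr f a * b + CliffordAlgebra.involute a * contr f b := by
  unfold contr
  induction a using CliffordAlgebra.left_induction with
  | algebraMap r => simp [CliffordAlgebra.contractLeft_algebraMap_mul]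
  | add x y h1 h2 => simp only [add_mul, map_add, h1, h2]; abel
  | ι_mul x v h =>
    rw [mul_assoc, CliffordAlgebra.contractLeft_ι_mul, h, CliffordAlgebra.contractLeft_ι_mul,
      map_mul, CliffordAlgebra.involute_ι]
    simp only [mul_add, sub_mul, smul_mul_assoc, neg_mul, mul_assoc]
    abel

/-- The functional on the generators of `Λᵐ` induced by a functional on those of `Λⁿ` and a map
`[m] → [n]`. -/
def pullDual {m : SimplexCategory} (α : m ⟶ n) (f : LamDual k n) : LamDual k m :=
  f ∘ₗ Finsupp.lmapDomain k k α.toOrderHom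

lemma lamMap_iota {m : SimplexCategory} (α : m ⟶ n) (v : Fin (m.len + 1) →₀ k) :
    lamMap k α (ExteriorAlgebra.ι k v) =
      ExteriorAlgebra.ι k (Finsupp.lmapDomain k k α.toOrderHom v) :=
  ExteriorAlgebra.map_apply_ι _ _

lemma contr_lamMap {m : SimplexCategory} (α : m ⟶ n) (f : LamDual k n) (x : Lam k m) :
    contr f (lamMap k α x) = lamMap k α (contr (pullDual α f) x) := by
  induction x using CliffordAlgebra.left_induction with
  | algebraMap r =>
    rw [AlgHom.commutes]
    erw [contr_algebraMap, contr_algebraMap]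
    rw [map_zero]
  | add x y h1 h2 => simp only [map_add, h1, h2]
  | ι_mul x v h =>
    change contr f (lamMap k α (ExteriorAlgebra.ι k v * x)) =
      lamMap k α (contr (pullDual α f) (ExteriorAlgebra.ι k v * x))
    rw [map_mul (lamMap k α), lamMap_iota, contr_iota_mul, h, contr_iota_mul, map_sub, map_smul,
      map_mul (lamMap k α), lamMap_iota]
    rfl

lemma algebraMapInv_lamMap {m : SimplexCategory} (α : m ⟶ n) (x : Lam k m) :
    ExteriorAlgebra.algebraMapInv (lamMap k α x) = ExteriorAlgebra.algebraMapInv x := by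
  have : (ExteriorAlgebra.algebraMapInv).comp (lamMap k α) =
      (ExteriorAlgebra.algebraMapInv : Lam k m →ₐ[k] k) := by
    ext v
    simp [lamMap, ExteriorAlgebra.algebraMapInv]
  exact DFunLike.congr_fun this x

lemma iterContr_lamMap {m : SimplexCategory} (α : m ⟶ n) (fs : List (LamDual k n))
    (x : Lam k m) : iterContr fs (lamMap k α x) = iterContr (fs.map (pullDual α)) x := by
  induction fs generalizing x with
  | nil => exact algebraMapInv_lamMap α x
  | cons f fs ih => rw [iterContr_cons, contr_lamMap, ih]; rfl

lemma contr_mem_aux (f : LamDual k n) {i : ℕ} {x : Lam k n} (hx : x ∈ lamDeg k n i) :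
    (i = 0 → contr f x = 0) ∧ ∀ j, i = j + 1 → contr f x ∈ lamDeg k n j := by
  induction hx using Submodule.pow_induction_on_left' with
  | algebraMap r =>
    exact ⟨fun _ => contr_algebraMap _ _, fun j h => by omega⟩
  | add x y i hx hy h1 h2 =>
    exact ⟨fun h => by rw [map_add, h1.1 h, h2.1 h, add_zero],
      fun j h => by rw [map_add]; exact add_mem (h1.2 j h) (h2.2 j h)⟩
  | mem_mul m hm i x hx h =>
    obtain ⟨v, rfl⟩ := hm
    refine ⟨fun h => by omega, fun j hj => ?_⟩
    obtain rfl : i = j := by omega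
    rw [contr_iota_mul]
    refine sub_mem (Submodule.smul_mem _ _ hx) ?_
    cases i with
    | zero => rw [h.1 rfl, mul_zero]; exact zero_mem _
    | succ i =>
      have h3 : lamDeg k n (i + 1) = LinearMap.range (ExteriorAlgebra.ι k) * lamDeg k n i :=
        pow_succ' _ _
      rw [h3]
      exact Submodule.mul_mem_mul ⟨v, rfl⟩ (h.2 i rfl)

lemma contr_mem (f : LamDual k n) {i : ℕ} {x : Lam k n} (hx : x ∈ lamDeg k n (i + 1)) :
    contr f x ∈ lamDeg k n i :=
  (contr_mem_aux f hx).2 i rfl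

lemma contr_zero (f : LamDual k n) {x : Lam k n} (hx : x ∈ lamDeg k n 0) : contr f x = 0 :=
  (contr_mem_aux f hx).1 rfl

lemma algebraMapInv_of_mem {i : ℕ} {x : Lam k n} (hx : x ∈ lamDeg k n (i + 1)) :
    ExteriorAlgebra.algebraMapInv x = 0 := by
  have h3 : lamDeg k n (i + 1) = LinearMap.range (ExteriorAlgebra.ι k) * lamDeg k n i :=
    pow_succ' _ _
  rw [h3] at hx
  induction hx using Submodule.mul_induction_on' with
  | mem_mul_mem a ha b hb =>
    obtain ⟨v, rfl⟩ := ha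
    simp [ExteriorAlgebra.algebraMapInv]
  | add x _ y _ h1 h2 => rw [map_add, h1, h2, add_zero]

/-- Each contraction lowers the exterior degree by one and the scalar part sees only degree zero, so
a list of length `p` detects exactly the component of degree `p`. -/
lemma iterContr_of_mem (fs : List (LamDual k n)) {i : ℕ} {x : Lam k n} (hx : x ∈ lamDeg k n i)
    (hi : i ≠ fs.length) : iterContr fs x = 0 := by
  induction fs generalizing i x with
  | nil =>
    obtain ⟨j, rfl⟩ := Nat.exists_eq_succ_of_ne_zero hi
    exact algebraMapInv_of_mem hx
  | cons f fs ih =>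
    rw [iterContr_cons]
    cases i with
    | zero => rw [contr_zero f hx, map_zero]
    | succ i => exact ih (contr_mem f hx) fun h => hi (by simp [h])

lemma lamDeg_eq_bot {i : ℕ} (hi : n.len + 1 < i) : lamDeg k n i = ⊥ := by
  have h := exteriorPower.finrank_eq (R := k) (M := Fin (n.len + 1) →₀ k) (n := i)
  rw [Module.finrank_finsupp_self, Fintype.card_fin, Nat.choose_eq_zero_of_lt hi] at h
  exact Submodule.finrank_eq_zero.mp h

/-- The functional dual to a generator. -/
def coordDual (k : Type u) [Field k] {n : SimplexCategory} (i : Fin (n.len + 1)) : LamDual k n :=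
  Finsupp.lapply i

/-- The operator on the left is the even derivation fixing every generator, so it counts degree.
Division by `i` is where characteristic zero enters: it recovers an element from its contractions.
-/
lemma euler_identity {i : ℕ} {x : Lam k n} (hx : x ∈ lamDeg k n i) :
    ∑ j, ExteriorAlgebra.ι k (Finsupp.single j 1) * contr (coordDual k j) x = (i : k) • x := by
  induction hx using Submodule.pow_induction_on_left' with
  | algebraMap r =>
    simp only [Nat.cast_zero, zero_smul]
    refine Finset.sum_eq_zero fun j _ => ?_
    erw [contr_algebraMap]
    rw [mul_zero]
  | add x y i hx hy h1 h2 => simp only [map_add, mul_add, Finset.sum_add_distrib, h1, h2, smul_add]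
  | mem_mul m hm i x hx h =>
    obtain ⟨v, rfl⟩ := hm
    simp only [contr_iota_mul, mul_sub, Finset.sum_sub_distrib]
    have h1 : ∑ j, ExteriorAlgebra.ι k (Finsupp.single j 1) * coordDual k j v • x =
        ExteriorAlgebra.ι k v * x := by
      simp only [mul_smul_comm, ← smul_mul_assoc]
      rw [← Finset.sum_mul]
      congr 1
      simp only [← map_smul]
      rw [← map_sum]
      congr 1
      simp [coordDual, Finsupp.univ_sum_single]
    have h2 : ∀ j, ExteriorAlgebra.ι k (Finsupp.single j 1) *
        (ExteriorAlgebra.ι k v * contr (coordDual k j) x) = - (ExteriorAlgebra.ι k v *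
          (ExteriorAlgebra.ι k (Finsupp.single j 1) * contr (coordDual k j) x)) := fun j => by
      rw [← mul_assoc, ← mul_assoc,
        eq_neg_of_add_eq_zero_left (ExteriorAlgebra.ι_add_mul_swap (Finsupp.single j 1) v), neg_mul]
    rw [h1, Finset.sum_congr rfl fun j _ => h2 j, Finset.sum_neg_distrib, ← Finset.mul_sum, h]
    rw [mul_smul_comm, sub_neg_eq_add, Nat.succ_eq_add_one, Nat.cast_add, add_smul, Nat.cast_one,
      one_smul, add_comm]

lemma mem_lamDeg_zero {x : Lam k n} (hx : x ∈ lamDeg k n 0) :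
    x = ExteriorAlgebra.algebraMapInv x • 1 := by
  change x ∈ LinearMap.range (ExteriorAlgebra.ι k) ^ 0 at hx
  rw [pow_zero] at hx
  obtain ⟨r, rfl⟩ := Submodule.mem_one.mp hx
  rw [← Algebra.algebraMap_eq_smul_one, ExteriorAlgebra.algebraMap_leftInverse]

/-- Iterate the Euler identity, dividing by the degree at each step. The lists and the vectors do
not depend on `x`, so the expansion can later be tensored with any `C`. -/
lemma exists_expansion_lamDeg [CharZero k] (n : SimplexCategory) (p : ℕ) :
    ∃ (J : Type) (_ : Fintype J) (s : J → List (Fin (n.len + 1))) (w : J → Lam k n),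
      (∀ j, (s j).length = p) ∧ (∀ j, w j ∈ lamDeg k n p) ∧
      ∀ x ∈ lamDeg k n p, x = ∑ j, iterContr ((s j).map (coordDual k)) x • w j := by
  induction p with
  | zero =>
    refine ⟨Unit, inferInstance, fun _ => [], fun _ => 1, fun _ => rfl,
      fun _ => SetLike.one_mem_graded (lamDeg k n), fun x hx => ?_⟩
    rw [Fintype.sum_unique]
    exact mem_lamDeg_zero hx
  | succ p ih =>
    obtain ⟨J, _, s, w, hs, hw, hx⟩ := ih
    refine ⟨Fin (n.len + 1) × J, inferInstance, fun j => j.1 :: s j.2,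
      fun j => ((p + 1 : ℕ) : k)⁻¹ • (ExteriorAlgebra.ι k (Finsupp.single j.1 1) * w j.2),
      fun j => by simp [hs], fun j => Submodule.smul_mem _ _ ?_, fun x h => ?_⟩
    · have h3 : lamDeg k n (p + 1) = LinearMap.range (ExteriorAlgebra.ι k) * lamDeg k n p :=
        pow_succ' _ _
      rw [h3]
      exact Submodule.mul_mem_mul ⟨_, rfl⟩ (hw _)
    · have h0 : ((p + 1 : ℕ) : k) ≠ 0 := Nat.cast_ne_zero.mpr (by omega)
      have h1 := euler_identity h
      rw [eq_comm, ← eq_inv_smul_iff₀ h0] at h1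
      refine h1.trans ?_
      rw [Finset.smul_sum, Fintype.sum_prod_type]
      refine Finset.sum_congr rfl fun i _ => ?_
      conv_lhs => rw [hx _ (contr_mem (coordDual k i) h)]
      rw [Finset.mul_sum, Finset.smul_sum]
      refine Finset.sum_congr rfl fun j _ => ?_
      rw [mul_smul_comm, smul_comm]
      rfl

/-- Every element of `Λⁿ` is determined by the values of the iterated contractions. -/
lemma exists_expansion [CharZero k] (n : SimplexCategory) :
    ∃ (J : Type) (_ : Fintype J) (s : J → List (Fin (n.len + 1))) (w : J → Lam k n),
      (∀ j, (s j).length ≤ n.len + 1) ∧ (∀ j, w j ∈ lamDeg k n (s j).length) ∧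
      ∀ x : Lam k n, x = ∑ j, iterContr ((s j).map (coordDual k)) x • w j := by
  choose J hJ s w hs hw hx using exists_expansion_lamDeg (k := k) n
  -- There are `n.len + 1` generators, so the exterior powers of degrees `0` to `n.len + 1` are all
  -- that matter.
  refine ⟨Σ p : Fin (n.len + 2), J p, inferInstance, fun j => s j.1 j.2, fun j => w j.1 j.2,
    fun j => by rw [hs]; omega, fun j => by rw [hs]; exact hw _ _, fun x => ?_⟩
  induction x using DirectSum.Decomposition.inductionOn (lamDeg k n) with
  | zero => simp
  | @homogeneous i m =>
    rw [Fintype.sum_sigma]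
    by_cases hi : i < n.len + 2
    · rw [Finset.sum_eq_single ⟨i, hi⟩]
      · exact hx i m m.2
      · refine fun p _ hp => Finset.sum_eq_zero fun j _ => ?_
        rw [iterContr_of_mem _ m.2, zero_smul]
        rw [List.length_map, hs]
        exact fun h => hp (Fin.ext h.symm)
      · simp
    · have hm : (m : Lam k n) = 0 :=
        (Submodule.mem_bot k).mp ((lamDeg_eq_bot (k := k) (n := n) (i := i) (by omega)).le m.2)
      simp [hm]
  | add x y h1 h2 =>
    simp only [map_add, add_smul, Finset.sum_add_distrib]
    rw [← h1, ← h2]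

end Lam

/-! ### Joins of simplices -/

section Join

/-- The join of two simplices. -/
def join (n m : SimplexCategory) : SimplexCategory := SimplexCategory.mk (n.len + m.len + 1)

/-- The inclusion of `[n]` into the join of `[n]` and `[m]`. -/
def joinFst (n m : SimplexCategory) : n ⟶ join n m :=
  SimplexCategory.Hom.mk ⟨fun i => ⟨i.1, by change i.1 < n.len + m.len + 1 + 1; omega⟩,
    fun _ _ h => h⟩

/-- The inclusion of `[m]` into the join of `[n]` and `[m]`. -/
def joinSnd (n m : SimplexCategory) : m ⟶ join n m :=
  SimplexCategory.Hom.mk ⟨fun i => ⟨n.len + 1 + i.1, by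
      change n.len + 1 + i.1 < n.len + m.len + 1 + 1; omega⟩,
    fun _ _ h => Nat.add_le_add_left h _⟩

variable {n m : SimplexCategory}

/-- The extension of a functional by zero to the join. -/
def extFst (m : SimplexCategory) (f : LamDual k n) : LamDual k (join n m) :=
  Finsupp.linearCombination k fun i =>
    if h : i.1 < n.len + 1 then f (Finsupp.single ⟨i.1, h⟩ 1) else 0

/-- The extension of a functional by zero to the join. -/
def extSnd (n : SimplexCategory) (f : LamDual k m) : LamDual k (join n m) :=
  Finsupp.linearCombination k fun i =>
    if h : n.len + 1 ≤ i.1 then f (Finsupp.single ⟨i.1 - (n.len + 1), by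
      have : i.1 < n.len + m.len + 1 + 1 := i.2
      omega⟩ 1) else 0

lemma pullDual_fst_extFst (f : LamDual k n) : pullDual (joinFst n m) (extFst m f) = f := by
  refine Finsupp.lhom_ext' fun i => LinearMap.ext_ring ?_
  simp only [pullDual, extFst, LinearMap.comp_apply, Finsupp.lmapDomain_apply,
    Finsupp.lsingle_apply, Finsupp.mapDomain_single, Finsupp.linearCombination_single, one_smul]
  exact dif_pos i.2

lemma pullDual_snd_extFst (f : LamDual k n) : pullDual (joinSnd n m) (extFst m f) = 0 := by
  refine Finsupp.lhom_ext' fun i => LinearMap.ext_ring ?_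
  simp only [pullDual, extFst, LinearMap.comp_apply, Finsupp.lmapDomain_apply,
    Finsupp.lsingle_apply, Finsupp.mapDomain_single, Finsupp.linearCombination_single, one_smul]
  exact dif_neg (show ¬ n.len + 1 + i.1 < n.len + 1 by omega)

lemma pullDual_snd_extSnd (f : LamDual k m) : pullDual (joinSnd n m) (extSnd n f) = f := by
  refine Finsupp.lhom_ext' fun i => LinearMap.ext_ring ?_
  simp only [pullDual, extSnd, LinearMap.comp_apply, Finsupp.lmapDomain_apply,
    Finsupp.lsingle_apply, Finsupp.mapDomain_single, Finsupp.linearCombination_single, one_smul]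
  refine (dif_pos (show n.len + 1 ≤ n.len + 1 + i.1 by omega)).trans ?_
  congr 2
  exact Fin.ext (show n.len + 1 + i.1 - (n.len + 1) = i.1 by omega)

lemma pullDual_fst_extSnd (f : LamDual k m) : pullDual (joinFst n m) (extSnd n f) = 0 := by
  refine Finsupp.lhom_ext' fun i => LinearMap.ext_ring ?_
  simp only [pullDual, extSnd, LinearMap.comp_apply, Finsupp.lmapDomain_apply,
    Finsupp.lsingle_apply, Finsupp.mapDomain_single, Finsupp.linearCombination_single, one_smul]
  exact dif_neg (show ¬ n.len + 1 ≤ i.1 by omega)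

lemma contr_zero_left (x : Lam k n) : contr (0 : LamDual k n) x = 0 := by
  simp [contr]

lemma involute_lamMap (α : n ⟶ m) (x : Lam k n) :
    CliffordAlgebra.involute (lamMap k α x) = lamMap k α (CliffordAlgebra.involute x) := by
  have : (CliffordAlgebra.involute (Q := (0 : QuadraticForm k _))).comp (lamMap k α) =
      (lamMap k α).comp (CliffordAlgebra.involute (Q := (0 : QuadraticForm k _))) := by
    refine CliffordAlgebra.hom_ext (LinearMap.ext fun v => ?_)
    change CliffordAlgebra.involute (lamMap k α (ExteriorAlgebra.ι k v)) =
      lamMap k α (CliffordAlgebra.involute (ExteriorAlgebra.ι k v))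
    have h : ∀ (l : SimplexCategory) (v : Fin (l.len + 1) →₀ k),
        CliffordAlgebra.involute (ExteriorAlgebra.ι k v) = - ExteriorAlgebra.ι k v := fun l v =>
      CliffordAlgebra.involute_ι _
    rw [lamMap_iota, h, h, map_neg, lamMap_iota]
  exact DFunLike.congr_fun this x

lemma algebraMapInv_involute (x : Lam k n) :
    ExteriorAlgebra.algebraMapInv (CliffordAlgebra.involute x) =
      ExteriorAlgebra.algebraMapInv (R := k) x := by
  have : (ExteriorAlgebra.algebraMapInv).comp
      (CliffordAlgebra.involute (Q := (0 : QuadraticForm k (Fin (n.len + 1) →₀ k)))) =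
      (ExteriorAlgebra.algebraMapInv : Lam k n →ₐ[k] k) := by
    refine CliffordAlgebra.hom_ext (LinearMap.ext fun v => ?_)
    change ExteriorAlgebra.algebraMapInv (CliffordAlgebra.involute (ExteriorAlgebra.ι k v)) =
      ExteriorAlgebra.algebraMapInv (R := k) (ExteriorAlgebra.ι k v)
    have h : CliffordAlgebra.involute (ExteriorAlgebra.ι k v) = - ExteriorAlgebra.ι k v :=
      CliffordAlgebra.involute_ι _
    rw [h, map_neg]
    simp [ExteriorAlgebra.algebraMapInv]
  exact DFunLike.congr_fun this x

/-- Moving a contraction past the first factor costs only a grade involution, which does not change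
the scalar part. -/
lemma iterContr_extSnd_mul (gs : List (LamDual k m)) (x : Lam k n) (y : Lam k m) :
    iterContr (gs.map (extSnd n)) (lamMap k (joinFst n m) x * lamMap k (joinSnd n m) y) =
      ExteriorAlgebra.algebraMapInv x * iterContr gs y := by
  induction gs generalizing x y with
  | nil =>
    rw [List.map_nil, iterContr_nil, map_mul, algebraMapInv_lamMap, algebraMapInv_lamMap]; rfl
  | cons g gs ih =>
    rw [List.map_cons, iterContr_cons, contr_mul, contr_lamMap, contr_lamMap, pullDual_fst_extSnd,
      pullDual_snd_extSnd, contr_zero_left, map_zero, zero_mul, zero_add, involute_lamMap, ih,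
      algebraMapInv_involute]
    rfl

/-- Functionals extended by zero see only their own block of vertices, so the first list acts on the
left factor alone and the second one on the right factor. -/
lemma iterContr_join (fs : List (LamDual k n)) (gs : List (LamDual k m)) (x : Lam k n)
    (y : Lam k m) :
    iterContr (fs.map (extFst m) ++ gs.map (extSnd n))
      (lamMap k (joinFst n m) x * lamMap k (joinSnd n m) y) = iterContr fs x * iterContr gs y := by
  induction fs generalizing x with
  | nil => exact iterContr_extSnd_mul gs x y
  | cons f fs ih =>
    rw [List.map_cons, List.cons_append, iterContr_cons, contr_mul, contr_lamMap, contr_lamMap,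
      pullDual_fst_extFst, pullDual_snd_extFst, contr_zero_left, map_zero, mul_zero, add_zero, ih]
    rfl

end Join

/-! ### Coefficients of elements of `C ⊗ Λⁿ` -/

section Coefficients

variable {C D : CDGA k} {n m : SimplexCategory}

/-- The coefficient map `C ⊗ Λⁿ → C` given by an iterated contraction. -/
def coeff (fs : List (LamDual k n)) : TensorLam C n →ₗ[k] C.carrier :=
  (TensorProduct.rid k C.carrier).toLinearMap ∘ₗ
    TensorProduct.map LinearMap.id (iterContr fs) ∘ₗ
      (GradedTensorProduct.of k C.deg (lamDeg k n)).symm.toLinearMap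

lemma coeff_tm (fs : List (LamDual k n)) (a : C.carrier) (x : Lam k n) :
    coeff fs (tm C n a x) = iterContr fs x • a := rfl

lemma tensorLam_hom_ext {M : Type*} [AddCommMonoid M] [Module k M] {f g : TensorLam C n →ₗ[k] M}
    (h : ∀ a x, f (tm C n a x) = g (tm C n a x)) : f = g := by
  refine LinearMap.ext fun t => ?_
  obtain ⟨t, rfl⟩ := (GradedTensorProduct.of k C.deg (lamDeg k n)).surjective t
  induction t using TensorProduct.induction_on with
  | zero => simp
  | tmul a x => exact h a x
  | add x y h1 h2 => rw [map_add, map_add, map_add, h1, h2]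

lemma coeff_tensorMap (f : C ⟶ D) (α : m ⟶ n) (fs : List (LamDual k n)) (t : TensorLam C m) :
    coeff fs (tensorMap f α t) = CDGA.Hom.toAlgHom f (coeff (fs.map (pullDual α)) t) := by
  have : coeff fs ∘ₗ tensorMap f α =
      (CDGA.Hom.toAlgHom f).toLinearMap ∘ₗ coeff (fs.map (pullDual α)) := by
    refine tensorLam_hom_ext fun a x => ?_
    simp only [LinearMap.comp_apply, tensorMap_tm, coeff_tm, AlgHom.toLinearMap_apply, map_smul,
      iterContr_lamMap]
  exact LinearMap.congr_fun this t

lemma coeff_mem (fs : List (LamDual k n)) {t : TensorLam C n} (ht : t ∈ tensorZero C n) :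
    coeff fs t ∈ C.deg fs.length := by
  induction ht using Submodule.span_induction with
  | mem t ht =>
    obtain ⟨i, a, x, ha, hx, rfl⟩ := ht
    rw [coeff_tm]
    by_cases hi : i = fs.length
    · subst hi
      exact Submodule.smul_mem _ _ ha
    · rw [iterContr_of_mem fs hx hi, zero_smul]
      exact zero_mem _
  | zero => simp
  | add x y _ _ h1 h2 => rw [map_add]; exact add_mem h1 h2
  | smul r x _ h => rw [map_smul]; exact Submodule.smul_mem _ _ h

/-- Only the component of `C`-degree `fs.length + 1` contributes to the last term, so the Koszul
sign, which varies with the component, becomes a single global sign. -/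
lemma coeff_tensorD (fs : List (LamDual k n)) {t : TensorLam C n} (ht : t ∈ tensorZero C n) :
    coeff fs (tensorD C n t) =
      C.d (coeff fs t) + (-1 : k) ^ (fs.length + 1) • coeff (lamFunctional k n :: fs) t := by
  induction ht using Submodule.span_induction with
  | mem t ht =>
    obtain ⟨i, a, x, ha, hx, rfl⟩ := ht
    rw [tensorD_tm ha, map_add, map_smul, coeff_tm, coeff_tm, coeff_tm, coeff_tm, map_smul]
    congr 1
    by_cases hi : i = fs.length + 1
    · subst hi; rfl
    · have : iterContr (lamFunctional k n :: fs) x = 0 := iterContr_of_mem _ hx hi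
      rw [this]
      have h' : iterContr fs (lamD k n x) = 0 := this
      rw [h']
      simp
  | zero => simp
  | add x y _ _ h1 h2 => simp only [map_add, h1, h2, smul_add]; abel
  | smul r x _ h => simp only [map_smul, h, smul_add]; rw [smul_comm]

/-- This is the cocycle condition read off on coefficients; it makes the span of the coefficients
stable under `d`. -/
lemma d_coeff (fs : List (LamDual k n)) (t : kSubalgebra C n) :
    C.d (coeff fs (t : TensorLam C n)) =
      (-1 : k) ^ fs.length • coeff (lamFunctional k n :: fs) (t : TensorLam C n) := by
  have h := coeff_tensorD fs t.2.1
  rw [t.2.2, map_zero] at h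
  rw [eq_neg_of_add_eq_zero_left h.symm, pow_succ, mul_neg_one, neg_smul, neg_neg]

/-- The sign comes from moving an exterior part of degree `fs.length` past a `C`-part of degree
`gs.length`. The formula makes the span of the coefficients a subalgebra. -/
lemma coeff_join (fs : List (LamDual k n)) (gs : List (LamDual k m)) {s : TensorLam C n}
    (hs : s ∈ tensorZero C n) {t : TensorLam C m} (ht : t ∈ tensorZero C m) :
    coeff (fs.map (extFst m) ++ gs.map (extSnd n))
      (tensorMap (𝟙 C) (joinFst n m) s * tensorMap (𝟙 C) (joinSnd n m) t) =
      (-1 : k) ^ (fs.length * gs.length) • (coeff fs s * coeff gs t) := by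
  induction hs, ht using Submodule.span_induction₂ with
  | mem_mem s t hs ht =>
    obtain ⟨i, a, x, ha, hx, rfl⟩ := hs
    obtain ⟨j, b, y, hb, hy, rfl⟩ := ht
    rw [tensorMap_tm, tensorMap_tm, tm_mul_tm _ (lamMap_mem _ hx) (CDGA.Hom.map_deg (𝟙 C) j b hb),
      map_smul, coeff_tm, coeff_tm, coeff_tm, iterContr_join, smul_mul_smul_comm]
    by_cases hi : i = fs.length
    · by_cases hj : j = gs.length
      · rw [hi, hj]; rfl
      · rw [iterContr_of_mem gs hy hj]; simp
    · rw [iterContr_of_mem fs hx hi]; simp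
  | zero_left y hy => simp
  | zero_right x hx => simp
  | add_left x y z _ _ _ h1 h2 => simp only [add_mul, map_add, h1, h2, smul_add]
  | add_right x y z _ _ _ h1 h2 => simp only [mul_add, map_add, h1, h2, smul_add]
  | smul_left r x y _ _ h =>
    simp only [smul_mul_assoc, map_smul, h]; rw [smul_comm]
  | smul_right r x y _ _ h =>
    simp only [mul_smul_comm, map_smul, h]; rw [smul_comm]

/-- Every element of `C ⊗ Λⁿ` is determined by its coefficients. -/
lemma exists_tensor_expansion [CharZero k] (n : SimplexCategory) :
    ∃ (J : Type) (_ : Fintype J) (s : J → List (Fin (n.len + 1))) (w : J → Lam k n),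
      (∀ j, (s j).length ≤ n.len + 1) ∧ (∀ j, w j ∈ lamDeg k n (s j).length) ∧
      ∀ (C : CDGA k) (t : TensorLam C n),
        t = ∑ j, tm C n (coeff ((s j).map (coordDual k)) t) (w j) := by
  obtain ⟨J, hJ, s, w, hs, hw, hx⟩ := exists_expansion (k := k) n
  refine ⟨J, hJ, s, w, hs, hw, fun C t => ?_⟩
  let tmR (y : Lam k n) : C.carrier →ₗ[k] TensorLam C n :=
    { toFun := fun a => tm C n a y
      map_add' := fun a b => add_tm a b y
      map_smul' := fun r a => smul_tm r a y }
  have : LinearMap.id = ∑ j, tmR (w j) ∘ₗ coeff (C := C) ((s j).map (coordDual k)) := by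
    refine tensorLam_hom_ext fun a x => ?_
    rw [LinearMap.id_apply, LinearMap.sum_apply]
    let tmL : Lam k n →ₗ[k] TensorLam C n :=
      { toFun := fun y => tm C n a y
        map_add' := fun y z => tm_add a y z
        map_smul' := fun r y => tm_smul r a y }
    refine (congrArg tmL (hx x)).trans ?_
    rw [map_sum]
    refine Finset.sum_congr rfl fun j _ => ?_
    change tm C n a _ = tm C n (coeff _ _) (w j)
    rw [coeff_tm, smul_tm, tm_smul]
  have h := LinearMap.congr_fun this t
  rw [LinearMap.sum_apply] at h
  exact h

lemma tensor_ext [CharZero k] {s t : TensorLam C n}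
    (h : ∀ fs : List (LamDual k n), fs.length ≤ n.len + 1 → coeff fs s = coeff fs t) : s = t := by
  obtain ⟨J, _, σ, w, hl, -, hx⟩ := exists_tensor_expansion (k := k) n
  rw [hx C s, hx C t]
  exact Finset.sum_congr rfl fun j _ => by rw [h _ (by rw [List.length_map]; exact hl j)]

end Coefficients

/-! ### Nilpotence of the augmentation ideals of `K(C)` -/

section Nilpotent

variable {C : CDGA k} {n : SimplexCategory}

/-- The part of `(C ⊗ Λⁿ)⁰` in `C`-degree at least `j`. -/
def tensorFil (C : CDGA k) (n : SimplexCategory) (j : ℕ) : Submodule k (TensorLam C n) :=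
  Submodule.span k {t | ∃ (i : ℕ) (a : C.carrier) (x : Lam k n),
    j ≤ i ∧ a ∈ C.deg i ∧ x ∈ lamDeg k n i ∧ t = tm C n a x}

lemma tensorFil_mul {i j : ℕ} {s t : TensorLam C n} (hs : s ∈ tensorFil C n i)
    (ht : t ∈ tensorFil C n j) : s * t ∈ tensorFil C n (i + j) := by
  induction hs, ht using Submodule.span_induction₂ with
  | mem_mem s t hs ht =>
    obtain ⟨p, a, x, hp, ha, hx, rfl⟩ := hs
    obtain ⟨q, b, y, hq, hb, hy, rfl⟩ := ht
    rw [tm_mul_tm a hx hb y]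
    exact Submodule.smul_mem _ _ (Submodule.subset_span
      ⟨p + q, _, _, add_le_add hp hq, SetLike.mul_mem_graded ha hb,
        SetLike.mul_mem_graded hx hy, rfl⟩)
  | zero_left y hy => simp
  | zero_right x hx => simp
  | add_left x y z _ _ _ h1 h2 => rw [add_mul]; exact add_mem h1 h2
  | add_right x y z _ _ _ h1 h2 => rw [mul_add]; exact add_mem h1 h2
  | smul_left r x y _ _ h => rw [smul_mul_assoc]; exact Submodule.smul_mem _ _ h
  | smul_right r x y _ _ h => rw [mul_smul_comm]; exact Submodule.smul_mem _ _ h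

lemma coeff_tensorFil (fs : List (LamDual k n)) {j : ℕ} (hj : fs.length < j)
    {t : TensorLam C n} (ht : t ∈ tensorFil C n j) : coeff fs t = 0 := by
  induction ht using Submodule.span_induction with
  | mem t ht =>
    obtain ⟨i, a, x, hi, ha, hx, rfl⟩ := ht
    rw [coeff_tm, iterContr_of_mem fs hx (by omega), zero_smul]
  | zero => simp
  | add x y _ _ h1 h2 => rw [map_add, h1, h2, add_zero]
  | smul r x _ h => rw [map_smul, h, smul_zero]

lemma tensorZero_eq_fil : tensorZero C n = tensorFil C n 0 := by
  simp [tensorZero, tensorFil]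

/-- The scalar part is invariant under cosimplicial maps, so it can be computed after mapping to
`[0]`, where the element becomes zero. -/
lemma coeff_nil_of_mem_augIdeal {t : kSubalgebra C n} (ht : t ∈ augIdeal ((Kalg k).obj C) n) :
    coeff [] (t : TensorLam C n) = 0 := by
  have h : tensorMap (𝟙 C) (SimplexCategory.isTerminalZero.from n) (t : TensorLam C n) = 0 :=
    congrArg Subtype.val ht
  have h' := coeff_tensorMap (𝟙 C) (SimplexCategory.isTerminalZero.from n) [] (t : TensorLam C n)
  rw [h, map_zero] at h'
  exact h'.symm

/-- In the expansion, terms with empty list vanish and all others have positive `C`-degree. -/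
lemma augIdeal_le_fil [CharZero k] {t : kSubalgebra C n}
    (ht : t ∈ augIdeal ((Kalg k).obj C) n) : (t : TensorLam C n) ∈ tensorFil C n 1 := by
  obtain ⟨J, _, s, w, -, hw, hx⟩ := exists_tensor_expansion (k := k) n
  rw [hx C t]
  refine Submodule.sum_mem _ fun j _ => ?_
  rcases Nat.eq_zero_or_pos (s j).length with h0 | h0
  · rw [List.length_eq_zero_iff.mp h0, List.map_nil, coeff_nil_of_mem_augIdeal ht]
    have : tm C n 0 (w j) = 0 := by simp [tm]
    rw [this]
    exact zero_mem _
  · have h := coeff_mem ((s j).map (coordDual k)) t.2.1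
    rw [List.length_map] at h
    exact Submodule.subset_span ⟨_, _, _, h0, h, hw j, rfl⟩

lemma augIdeal_pow_le_fil [CharZero k] (j : ℕ) {t : kSubalgebra C n}
    (ht : t ∈ augIdeal ((Kalg k).obj C) n ^ j) : (t : TensorLam C n) ∈ tensorFil C n j := by
  induction j generalizing t with
  | zero => rw [← tensorZero_eq_fil]; exact t.2.1
  | succ j ih =>
    rw [pow_succ] at ht
    induction ht using Submodule.mul_induction_on' with
    | mem_mul_mem a ha b hb => exact tensorFil_mul (ih ha) (augIdeal_le_fil hb)
    | add x _ y _ h1 h2 => exact add_mem h1 h2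

lemma coeff_of_mem_augIdeal_pow [CharZero k] (fs : List (LamDual k n)) {j : ℕ}
    (hj : fs.length < j) {t : kSubalgebra C n} (ht : t ∈ augIdeal ((Kalg k).obj C) n ^ j) :
    coeff fs (t : TensorLam C n) = 0 :=
  coeff_tensorFil fs hj (augIdeal_pow_le_fil j ht)

/-- Coefficients of length at most `n.len + 1` determine an element, and all of these vanish on the
power `n.len + 2`. -/
lemma augIdeal_Kalg_pow [CharZero k] (C : CDGA k) (n : SimplexCategory) :
    augIdeal ((Kalg k).obj C) n ^ (n.len + 2) = ⊥ := by
  refine (Submodule.eq_bot_iff _).mpr fun t ht => ?_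
  refine Subtype.ext (tensor_ext fun fs hfs => ?_)
  rw [coeff_of_mem_augIdeal_pow fs (by omega) ht]
  exact (map_zero _).symm

end Nilpotent

/-! ### Subalgebras of products of cdgas -/

section OfEmbedding

variable {X : Type u} [Ring X] [Algebra k X] {I : Type*} (C : I → CDGA k)
  (ψ : ∀ i, X →ₐ[k] (C i).carrier)

/-- The elements of `X` all of whose components are of degree `n`. -/
def jointDeg (n : ℕ) : Submodule k X := ⨅ i, ((C i).deg n).comap (ψ i).toLinearMap

lemma mem_jointDeg {n : ℕ} {x : X} : x ∈ jointDeg C ψ n ↔ ∀ i, ψ i x ∈ (C i).deg n := by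
  simp [jointDeg]

/-- Homogeneous components can be read off inside each `C i`. Joint injectivity of the `ψ i` then
makes the sum of the joint degrees direct. -/
lemma jointDeg_proj (i : I) (x : DirectSum ℕ fun n => jointDeg C ψ n) (n : ℕ) :
    (DirectSum.decompose (C i).deg (ψ i (DirectSum.coeLinearMap (jointDeg C ψ) x)) n :
      (C i).carrier) = ψ i (x n) := by
  induction x using DirectSum.induction_on with
  | zero => simp
  | of m x =>
    have h := (mem_jointDeg C ψ).mp x.2 i
    rw [DirectSum.coeLinearMap_of, DirectSum.decompose_of_mem _ h]
    by_cases hm : m = n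
    · subst hm; simp
    · rw [DirectSum.of_eq_of_ne _ _ _ (Ne.symm hm), DirectSum.of_eq_of_ne _ _ _ (Ne.symm hm)]
      simp
  | add x y h1 h2 =>
    rw [map_add, map_add, DirectSum.decompose_add, DirectSum.add_apply, DirectSum.add_apply,
      Submodule.coe_add, Submodule.coe_add, map_add, h1, h2]

variable (inj : ∀ x, (∀ i, ψ i x = 0) → x = 0) (d : X →ₗ[k] X)
  (hd : ∀ i x, ψ i (d x) = (C i).d (ψ i x)) (hsum : ⨆ n, jointDeg C ψ n = ⊤)

include inj hsum in
lemma jointDeg_isInternal : DirectSum.IsInternal (jointDeg C ψ) := by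
  constructor
  · refine (injective_iff_map_eq_zero _).mpr fun x hx => ?_
    refine DFinsupp.ext fun n => Subtype.ext (inj _ fun i => ?_)
    rw [← jointDeg_proj C ψ i x n]
    have h : DirectSum.coeLinearMap (jointDeg C ψ) x = 0 := hx
    rw [h]
    simp
  · intro x
    have h : x ∈ ⨆ n, jointDeg C ψ n := by rw [hsum]; trivial
    rw [← DirectSum.range_coeLinearMap] at h
    exact h

/-- The cdga structure on an algebra that embeds compatibly in a product of cdgas. -/
def CDGA.ofEmbedding : CDGA k :=
  letI : DirectSum.Decomposition (jointDeg C ψ) :=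
    (jointDeg_isInternal C ψ inj hsum).chooseDecomposition
  { carrier := X
    deg := jointDeg C ψ
    graded :=
      { one_mem := (mem_jointDeg C ψ).mpr fun i => by
          rw [map_one]; exact SetLike.one_mem_graded _
        mul_mem := fun a b x y hx hy => (mem_jointDeg C ψ).mpr fun i => by
          rw [map_mul]
          exact SetLike.mul_mem_graded ((mem_jointDeg C ψ).mp hx i) ((mem_jointDeg C ψ).mp hy i) }
    d := d
    d_mem := fun n x hx => (mem_jointDeg C ψ).mpr fun i => by
      rw [hd]; exact (C i).d_mem n _ ((mem_jointDeg C ψ).mp hx i)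
    d_d := fun x => inj _ fun i => by rw [hd, hd, (C i).d_d]
    leibniz := fun m x y hx => sub_eq_zero.mp <| inj _ fun i => by
      simp only [map_sub, map_add, map_mul, map_smul, hd]
      rw [(C i).leibniz m _ _ ((mem_jointDeg C ψ).mp hx i), sub_self]
    comm := fun m n x y hx hy => sub_eq_zero.mp <| inj _ fun i => by
      simp only [map_sub, map_mul, map_smul]
      rw [(C i).comm m n _ _ ((mem_jointDeg C ψ).mp hx i) ((mem_jointDeg C ψ).mp hy i), sub_self] }

/-- The components of the embedding are morphisms of cdgas. -/
def CDGA.ofEmbeddingProj (i : I) : CDGA.ofEmbedding C ψ inj d hd hsum ⟶ C i :=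
  (⟨ψ i, fun _ _ hx => (mem_jointDeg C ψ).mp hx i, hd i⟩ : CDGA.Hom _ _)

end OfEmbedding

/-! ### The left adjoint of `K` -/

section LeftAdjoint

variable (A : CosimpAlg k)

/-- The cdgas with a morphism from `A` to their image under `K`. -/
abbrev Cone : Type (u + 1) := Σ C : CDGA k, A ⟶ (Kalg k).obj C

/-- The product of all the cdgas under `A`. -/
abbrev ConeProd : Type (u + 1) := (c : Cone A) → c.1.carrier

/-- The index set of the generators of `D(A)`. -/
abbrev GenIndex : Type u := Σ n : SimplexCategory, A.obj n × List (LamDual k n)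

variable {A}

/-- The element of `C ⊗ Λⁿ` that a morphism `A ⟶ K(C)` assigns to an element of `Aⁿ`. -/
def evalAt {C : CDGA k} (φ : A ⟶ (Kalg k).obj C) {n : SimplexCategory} (a : A.obj n) :
    kSubalgebra C n := (φ.app n).hom a

lemma evalAt_map {C : CDGA k} (φ : A ⟶ (Kalg k).obj C) {m n : SimplexCategory} (α : m ⟶ n)
    (a : A.obj m) :
    (evalAt φ ((A.map α).hom a) : TensorLam C n) = tensorMap (𝟙 C) α (evalAt φ a) :=
  congrArg Subtype.val (CategoryTheory.congr_fun (φ.naturality α) a)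

lemma evalAt_mul {C : CDGA k} (φ : A ⟶ (Kalg k).obj C) {n : SimplexCategory} (a b : A.obj n) :
    (evalAt φ (a * b) : TensorLam C n) = evalAt φ a * evalAt φ b :=
  congrArg Subtype.val (map_mul (φ.app n).hom a b)

lemma evalAt_one {C : CDGA k} (φ : A ⟶ (Kalg k).obj C) (n : SimplexCategory) :
    (evalAt φ (1 : A.obj n) : TensorLam C n) = 1 :=
  congrArg Subtype.val (map_one (φ.app n).hom)

lemma evalAt_comp {C C' : CDGA k} (φ : A ⟶ (Kalg k).obj C) (f : C ⟶ C') {n : SimplexCategory}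
    (a : A.obj n) : (evalAt (φ ≫ (Kalg k).map f) a : TensorLam C' n) =
      tensorMap f (𝟙 n) (evalAt φ a : TensorLam C n) := rfl

/-- A coefficient of an element of `A`, as a family indexed by the cdgas under `A`. -/
def gen (g : GenIndex A) : ConeProd A := fun c =>
  coeff g.2.2 (evalAt c.2 g.2.1 : TensorLam c.1 g.1)

/-- Push both elements to the join of their simplices and multiply there; the same choice works for
all cones at once. -/
lemma gen_mul (g h : GenIndex A) : ∃ (s : k) (l : GenIndex A), gen g * gen h = s • gen l := by
  obtain ⟨n, a, fs⟩ := g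
  obtain ⟨m, b, gs⟩ := h
  refine ⟨(-1) ^ (fs.length * gs.length), ⟨join n m, (A.map (joinFst n m)).hom a *
    (A.map (joinSnd n m)).hom b, fs.map (extFst m) ++ gs.map (extSnd n)⟩, funext fun c => ?_⟩
  change coeff fs (evalAt c.2 a : TensorLam c.1 n) * coeff gs (evalAt c.2 b : TensorLam c.1 m) =
    (-1 : k) ^ (fs.length * gs.length) • coeff (fs.map (extFst m) ++ gs.map (extSnd n))
      (evalAt c.2 ((A.map (joinFst n m)).hom a * (A.map (joinSnd n m)).hom b) :
        TensorLam c.1 (join n m))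
  rw [evalAt_mul, evalAt_map, evalAt_map, coeff_join fs gs (evalAt c.2 a).2.1 (evalAt c.2 b).2.1,
    smul_smul, ← mul_pow]
  simp

lemma gen_one : gen (A := A) ⟨SimplexCategory.mk 0, 1, []⟩ = 1 := by
  funext c
  change coeff [] (evalAt c.2 (1 : A.obj (SimplexCategory.mk 0)) :
    TensorLam c.1 (SimplexCategory.mk 0)) = 1
  rw [evalAt_one]
  change coeff [] (tm c.1 (SimplexCategory.mk 0) 1 1) = 1
  rw [coeff_tm, iterContr_nil, map_one, one_smul]

variable (A)

/-- The componentwise differential. -/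
def coneD : ConeProd A →ₗ[k] ConeProd A :=
  LinearMap.pi fun c => c.1.d ∘ₗ LinearMap.proj c

variable {A}

lemma coneD_gen (g : GenIndex A) : coneD A (gen g) =
    (-1 : k) ^ g.2.2.length • gen ⟨g.1, g.2.1, lamFunctional k g.1 :: g.2.2⟩ :=
  funext fun _ => d_coeff _ _

variable (A)

/-- The subalgebra of the product of all cdgas under `A` spanned by the coefficients. -/
def genSubalgebra : Subalgebra k (ConeProd A) :=
  (Submodule.span k (Set.range (gen (A := A)))).toSubalgebra
    (Submodule.subset_span ⟨_, gen_one⟩) (by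
      intro x y hx hy
      induction hx, hy using Submodule.span_induction₂ with
      | mem_mem x y hx hy =>
        obtain ⟨g, rfl⟩ := hx
        obtain ⟨h, rfl⟩ := hy
        obtain ⟨s, l, hl⟩ := gen_mul g h
        rw [hl]
        exact Submodule.smul_mem _ _ (Submodule.subset_span ⟨l, rfl⟩)
      | zero_left y hy => simp
      | zero_right x hx => simp
      | add_left x y z _ _ _ h1 h2 => rw [add_mul]; exact add_mem h1 h2
      | add_right x y z _ _ _ h1 h2 => rw [mul_add]; exact add_mem h1 h2
      | smul_left r x y _ _ h => rw [smul_mul_assoc]; exact Submodule.smul_mem _ _ h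
      | smul_right r x y _ _ h => rw [mul_smul_comm]; exact Submodule.smul_mem _ _ h)

variable {A}

lemma gen_mem (g : GenIndex A) : gen g ∈ genSubalgebra A := Submodule.subset_span ⟨g, rfl⟩

lemma coneD_mem {x : ConeProd A} (hx : x ∈ genSubalgebra A) : coneD A x ∈ genSubalgebra A := by
  change x ∈ Submodule.span k _ at hx
  induction hx using Submodule.span_induction with
  | mem x hx =>
    obtain ⟨g, rfl⟩ := hx
    rw [coneD_gen]
    exact Subalgebra.smul_mem _ (gen_mem _) _
  | zero => rw [map_zero]; exact zero_mem _
  | add x y _ _ h1 h2 => rw [map_add]; exact add_mem h1 h2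
  | smul r x _ h => rw [map_smul]; exact Subalgebra.smul_mem _ h _

/-- The product over all cones lives one universe too high, but the subalgebra is the image of a
free module on a basis in universe `u`. -/
instance : Small.{u} (genSubalgebra A) := by
  let f : (GenIndex A →₀ k) → genSubalgebra A := fun l =>
    ⟨Finsupp.linearCombination k gen l, by
      change _ ∈ Submodule.span k _
      rw [← Finsupp.range_linearCombination]
      exact ⟨l, rfl⟩⟩
  refine small_of_surjective (f := f) fun x => ?_
  have h : x.1 ∈ Submodule.span k (Set.range (gen (A := A))) := x.2
  rw [← Finsupp.range_linearCombination] at h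
  obtain ⟨l, hl⟩ := h
  exact ⟨l, Subtype.ext hl⟩

variable (A)

/-- The underlying algebra of `D(A)`. -/
abbrev DCarrier : Type u := Shrink.{u} (genSubalgebra A)

/-- The algebra of `D(A)` is a subalgebra of a product of cdgas. -/
def dEquiv : DCarrier A ≃ₐ[k] genSubalgebra A := Shrink.algEquiv k (genSubalgebra A)

variable {A}

/-- The components of elements of `D(A)`. -/
def dProj (c : Cone A) : DCarrier A →ₐ[k] c.1.carrier :=
  (Pi.evalAlgHom k _ c).comp ((genSubalgebra A).val.comp (dEquiv A).toAlgHom)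

lemma dProj_apply (c : Cone A) (x : DCarrier A) : dProj c x = (dEquiv A x).1 c := rfl

lemma dProj_inj (x : DCarrier A) (h : ∀ c, dProj c x = 0) : x = 0 := by
  refine (dEquiv A).injective (Subtype.ext (funext fun c => ?_))
  rw [map_zero]
  exact h c

variable (A) in
/-- The differential of `D(A)`. -/
def dDiff : DCarrier A →ₗ[k] DCarrier A :=
  (dEquiv A).symm.toLinearMap ∘ₗ
    ((coneD A).restrict (p := Subalgebra.toSubmodule (genSubalgebra A))
      (q := Subalgebra.toSubmodule (genSubalgebra A)) fun _ h => coneD_mem h) ∘ₗ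
      (dEquiv A).toLinearMap

lemma dProj_dDiff (c : Cone A) (x : DCarrier A) : dProj c (dDiff A x) = c.1.d (dProj c x) := by
  rw [dProj_apply, dDiff]
  simp only [LinearMap.comp_apply, AlgEquiv.toLinearMap_apply, AlgEquiv.apply_symm_apply]
  rfl

/-- The generators of `D(A)`. -/
def dGen (g : GenIndex A) : DCarrier A := (dEquiv A).symm ⟨gen g, gen_mem g⟩

lemma dProj_dGen (c : Cone A) (g : GenIndex A) : dProj c (dGen g) = gen g c := by
  rw [dProj_apply, dGen, AlgEquiv.apply_symm_apply]

lemma dGen_mem (g : GenIndex A) : dGen g ∈ jointDeg (fun c : Cone A => c.1) dProj g.2.2.length := by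
  rw [mem_jointDeg]
  intro c
  rw [dProj_dGen]
  exact coeff_mem _ (evalAt c.2 g.2.1).2.1

lemma span_dGen : Submodule.span k (Set.range (dGen (A := A))) = ⊤ := by
  refine Submodule.eq_top_iff'.mpr fun x => ?_
  obtain ⟨⟨y, hy⟩, rfl⟩ := (dEquiv A).symm.surjective x
  have hy' : y ∈ Submodule.span k (Set.range (gen (A := A))) := hy
  induction hy' using Submodule.span_induction with
  | mem y h =>
    obtain ⟨g, rfl⟩ := h
    exact Submodule.subset_span ⟨g, rfl⟩
  | zero =>
    have : (⟨0, hy⟩ : genSubalgebra A) = 0 := rfl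
    rw [this, map_zero]
    exact zero_mem _
  | add y z h1 h2 i1 i2 =>
    have : (⟨y + z, hy⟩ : genSubalgebra A) = ⟨y, h1⟩ + ⟨z, h2⟩ := rfl
    rw [this, map_add]
    exact add_mem (i1 h1) (i2 h2)
  | smul r y h1 i1 =>
    have : (⟨r • y, hy⟩ : genSubalgebra A) = r • ⟨y, h1⟩ := rfl
    rw [this, map_smul]
    exact Submodule.smul_mem _ _ (i1 h1)

lemma iSup_jointDeg : ⨆ n, jointDeg (fun c : Cone A => c.1) dProj n = ⊤ := by
  rw [eq_top_iff, ← span_dGen, Submodule.span_le]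
  rintro _ ⟨g, rfl⟩
  exact Submodule.mem_iSup_of_mem _ (dGen_mem g)

variable (A)

/-- The value of the left adjoint of `K` at `A`. -/
def dObj : CDGA k :=
  CDGA.ofEmbedding (fun c : Cone A => c.1) dProj dProj_inj (dDiff A) dProj_dDiff iSup_jointDeg

variable {A}

/-- The morphism `D(A) ⟶ C` that corresponds to a morphism `A ⟶ K(C)`. -/
def dObjProj (c : Cone A) : dObj A ⟶ c.1 :=
  CDGA.ofEmbeddingProj (fun c : Cone A => c.1) dProj dProj_inj (dDiff A) dProj_dDiff
    iSup_jointDeg c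

lemma dObj_ext {x y : (dObj A).carrier}
    (h : ∀ c : Cone A, CDGA.Hom.toAlgHom (dObjProj c) x = CDGA.Hom.toAlgHom (dObjProj c) y) :
    x = y := by
  have hx : ∀ x y : DCarrier A, (∀ c, dProj c x = dProj c y) → x = y := fun x y h =>
    sub_eq_zero.mp (dProj_inj _ fun c => by rw [map_sub, h c, sub_self])
  exact hx x y h

/-- The generators of `D(A)`. -/
def dObjGen (g : GenIndex A) : (dObj A).carrier := dGen g

lemma dObjProj_gen (c : Cone A) (g : GenIndex A) :
    CDGA.Hom.toAlgHom (dObjProj c) (dObjGen g) =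
      coeff g.2.2 (evalAt c.2 g.2.1 : TensorLam c.1 g.1) := dProj_dGen c g

lemma dObjGen_mem (g : GenIndex A) : dObjGen g ∈ (dObj A).deg g.2.2.length := dGen_mem g

lemma span_dObjGen : Submodule.span k (Set.range (dObjGen (A := A))) = ⊤ := span_dGen

lemma pullDual_id (n : SimplexCategory) : pullDual (k := k) (𝟙 n) = id := by
  funext f
  have h2 : Finsupp.lmapDomain k k (SimplexCategory.Hom.toOrderHom (𝟙 n)) =
      (LinearMap.id : (Fin (n.len + 1) →₀ k) →ₗ[k] _) := by
    rw [← Finsupp.lmapDomain_id]; rfl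
  rw [pullDual, h2]
  rfl

lemma coeff_tensorMap_id {C C' : CDGA k} (f : C ⟶ C') {n : SimplexCategory}
    (fs : List (LamDual k n)) (t : TensorLam C n) :
    coeff fs (tensorMap f (𝟙 n) t) = CDGA.Hom.toAlgHom f (coeff fs t) := by
  rw [coeff_tensorMap, pullDual_id, List.map_id]

lemma coeff_evalAt_comp {C C' : CDGA k} (φ : A ⟶ (Kalg k).obj C) (f : C ⟶ C')
    {n : SimplexCategory} (a : A.obj n) (fs : List (LamDual k n)) :
    coeff fs (evalAt (φ ≫ (Kalg k).map f) a : TensorLam C' n) =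
      CDGA.Hom.toAlgHom f (coeff fs (evalAt φ a : TensorLam C n)) := by
  rw [evalAt_comp, coeff_tensorMap_id]

lemma kMap_kMap {C C' C'' : CDGA k} (f : C ⟶ C') (g : C' ⟶ C'') {l m n : SimplexCategory}
    (α : l ⟶ m) (β : m ⟶ n) (t : kSubalgebra C l) :
    kMap g β (kMap f α t) = kMap (f ≫ g) (α ≫ β) t :=
  Subtype.ext (tensorMap_comp f g α β t).symm

variable [CharZero k]

lemma dObj_tensor_ext {n : SimplexCategory} {s t : TensorLam (dObj A) n}
    (h : ∀ c : Cone A, tensorMap (dObjProj c) (𝟙 n) s = tensorMap (dObjProj c) (𝟙 n) t) :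
    s = t :=
  tensor_ext fun fs _ => dObj_ext fun c => by
    rw [← coeff_tensorMap_id, ← coeff_tensorMap_id, h c]

/-- Substitute the generators of `D(A)` for the coefficients in the universal expansion. That the
result is a cocycle can be tested after projection to each cone, where it becomes the given cocycle.
-/
lemma exists_unit {n : SimplexCategory} (a : A.obj n) : ∃ t : kSubalgebra (dObj A) n,
    ∀ c : Cone A, tensorMap (dObjProj c) (𝟙 n) (t : TensorLam (dObj A) n) = evalAt c.2 a := by
  obtain ⟨J, _, s, w, -, hw, hx⟩ := exists_tensor_expansion (k := k) n
  let t : TensorLam (dObj A) n :=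
    ∑ j, tm (dObj A) n (dObjGen ⟨n, a, (s j).map (coordDual k)⟩) (w j)
  have ht : t ∈ tensorZero (dObj A) n := by
    refine Submodule.sum_mem _ fun j _ => Submodule.subset_span ⟨_, _, _, ?_, hw j, rfl⟩
    have := dObjGen_mem (A := A) ⟨n, a, (s j).map (coordDual k)⟩
    dsimp only at this
    rw [List.length_map] at this
    exact this
  have hp : ∀ c : Cone A, tensorMap (dObjProj c) (𝟙 n) t = evalAt c.2 a := fun c => by
    rw [hx c.1 (evalAt c.2 a : TensorLam c.1 n), map_sum]
    refine Finset.sum_congr rfl fun j _ => ?_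
    rw [tensorMap_tm, lamMap_id, dObjProj_gen]
  refine ⟨⟨t, ht, dObj_tensor_ext fun c => ?_⟩, hp⟩
  rw [tensorMap_tensorD _ _ ht, hp, map_zero]
  exact (evalAt c.2 a).2.2

lemma kSubalgebra_dObj_ext {n : SimplexCategory} {s t : kSubalgebra (dObj A) n}
    (h : ∀ c : Cone A, kMap (dObjProj c) (𝟙 n) s = kMap (dObjProj c) (𝟙 n) t) : s = t :=
  Subtype.ext (dObj_tensor_ext fun c => congrArg Subtype.val (h c))

/-- The unit of the adjunction, as a map. -/
def dUnitFun {n : SimplexCategory} (a : A.obj n) : kSubalgebra (dObj A) n := (exists_unit a).choose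

lemma kMap_dUnitFun (c : Cone A) {n : SimplexCategory} (a : A.obj n) :
    kMap (dObjProj c) (𝟙 n) (dUnitFun a) = evalAt c.2 a :=
  Subtype.ext ((exists_unit a).choose_spec c)

/-- The unit of the adjunction, as an algebra morphism. -/
def dUnitHom (n : SimplexCategory) : A.obj n →ₐ[k] kSubalgebra (dObj A) n where
  toFun := dUnitFun
  map_one' := kSubalgebra_dObj_ext fun c => by
    rw [kMap_dUnitFun, map_one]; exact map_one (c.2.app n).hom
  map_mul' a b := kSubalgebra_dObj_ext fun c => by
    rw [map_mul, kMap_dUnitFun, kMap_dUnitFun, kMap_dUnitFun]; exact map_mul (c.2.app n).hom a b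
  map_zero' := kSubalgebra_dObj_ext fun c => by
    rw [kMap_dUnitFun, map_zero]; exact map_zero (c.2.app n).hom
  map_add' a b := kSubalgebra_dObj_ext fun c => by
    rw [map_add, kMap_dUnitFun, kMap_dUnitFun, kMap_dUnitFun]; exact map_add (c.2.app n).hom a b
  commutes' r := kSubalgebra_dObj_ext fun c => by
    rw [kMap_dUnitFun, AlgHom.commutes]; exact (c.2.app n).hom.commutes r

variable (A) in
/-- The unit of the adjunction. -/
def dUnit : A ⟶ (Kalg k).obj (dObj A) where
  app n := CommAlgCat.ofHom (dUnitHom n)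
  naturality m n α := by
    refine CommAlgCat.hom_ext (AlgHom.ext fun a => kSubalgebra_dObj_ext fun c => ?_)
    change kMap (dObjProj c) (𝟙 n) (dUnitFun ((A.map α).hom a)) =
      kMap (dObjProj c) (𝟙 n) (kMap (𝟙 _) α (dUnitFun a))
    rw [kMap_dUnitFun, kMap_kMap, Category.id_comp, Category.comp_id,
      ← Category.comp_id (dObjProj c), ← Category.id_comp α, ← kMap_kMap, kMap_dUnitFun,
      Category.id_comp]
    exact Subtype.ext (evalAt_map c.2 α a)

lemma dUnit_comp (c : Cone A) : dUnit A ≫ (Kalg k).map (dObjProj c) = c.2 := by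
  refine NatTrans.ext (funext fun n => CommAlgCat.hom_ext (AlgHom.ext fun a => ?_))
  exact kMap_dUnitFun c a

/-- The generators are thus the coefficients of the unit, so a morphism out of `D(A)` is determined
by its composite with the unit. -/
lemma coeff_dUnit (g : GenIndex A) :
    coeff g.2.2 (evalAt (dUnit A) g.2.1 : TensorLam (dObj A) g.1) = dObjGen g :=
  dObj_ext fun c => by rw [← coeff_evalAt_comp, dUnit_comp, dObjProj_gen]

/-- The universal property of `D(A)`. -/
def dHomEquiv (A : CosimpAlg k) (C : CDGA k) : (dObj A ⟶ C) ≃ (A ⟶ (Kalg k).obj C) where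
  toFun f := dUnit A ≫ (Kalg k).map f
  invFun φ := dObjProj ⟨C, φ⟩
  left_inv f := by
    refine CDGA.Hom.ext (AlgHom.toLinearMap_injective (LinearMap.ext_on span_dObjGen ?_))
    rintro _ ⟨g, rfl⟩
    change CDGA.Hom.toAlgHom (dObjProj ⟨C, dUnit A ≫ (Kalg k).map f⟩) (dObjGen g) =
      CDGA.Hom.toAlgHom f (dObjGen g)
    rw [dObjProj_gen, ← coeff_dUnit, ← coeff_evalAt_comp]
  right_inv φ := dUnit_comp ⟨C, φ⟩

/-- The adjunction between `D` and `K`. -/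
def dAdj (k : Type u) [Field k] [CharZero k] :
    Adjunction.leftAdjointOfEquiv (G := Kalg k) (F_obj := dObj) dHomEquiv
      (fun A C C' f g => by simp [dHomEquiv]) ⊣ Kalg k :=
  Adjunction.adjunctionOfEquivLeft _ _

end LeftAdjoint

lemma isRightAdjoint_Kalg [CharZero k] : (Kalg k).IsRightAdjoint := ⟨_, ⟨dAdj k⟩⟩

/-! ### Generators of the values of an arbitrary left adjoint -/

lemma mem_span_of_homogeneous (C : CDGA k) {ι : Type*} (g : ι → C.carrier) (l : ι → ℕ)
    (hg : ∀ i, g i ∈ C.deg (l i)) {p : ℕ} {x : C.carrier} (hx : x ∈ Submodule.span k (Set.range g))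
    (hp : x ∈ C.deg p) : x ∈ Submodule.span k (g '' {i | l i = p}) := by
  -- Projection to degree `p` keeps the generators of that degree and kills the others.
  have : ∀ y ∈ Submodule.span k (Set.range g), (DirectSum.decompose C.deg y p : C.carrier) ∈
      Submodule.span k (g '' {i | l i = p}) := by
    intro y hy
    induction hy using Submodule.span_induction with
    | mem y hy =>
      obtain ⟨i, rfl⟩ := hy
      by_cases hi : l i = p
      · rw [DirectSum.decompose_of_mem_same _ (hi ▸ hg i)]
        exact Submodule.subset_span ⟨i, hi, rfl⟩
      · rw [DirectSum.decompose_of_mem_ne _ (hg i) hi]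
        exact zero_mem _
    | zero => simp
    | add y z _ _ h1 h2 => rw [DirectSum.decompose_add]; exact add_mem h1 h2
    | smul r y _ h => rw [DirectSum.decompose_smul]; exact Submodule.smul_mem _ _ h
  have h := this x hx
  rwa [DirectSum.decompose_of_mem_same _ hp] at h

/-- Each homogeneous element of `D(A)` is a combination of coefficients of elements of `A`. -/
lemma deg_le_span_coeff [CharZero k] {D : CosimpAlg k ⥤ CDGA k} (adj : D ⊣ Kalg k)
    (A : CosimpAlg k) (p : ℕ) :
    (D.obj A).deg p ≤ Submodule.span k {x | ∃ (n : SimplexCategory) (a : A.obj n)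
      (fs : List (LamDual k n)), fs.length = p ∧
        x = coeff fs (evalAt (adj.unit.app A) a : TensorLam (D.obj A) n)} := by
  intro x hx
  -- Compare with the explicit model through the two universal properties. Only `g ≫ f = 𝟙` is
  -- needed: it writes `x` as the image under `f` of a combination of generators.
  let f : dObj A ⟶ D.obj A := (dHomEquiv A (D.obj A)).symm (adj.unit.app A)
  have hf : dUnit A ≫ (Kalg k).map f = adj.unit.app A :=
    (dHomEquiv A (D.obj A)).apply_symm_apply _
  let g : D.obj A ⟶ dObj A := (adj.homEquiv A (dObj A)).symm (dUnit A)
  have hg : adj.unit.app A ≫ (Kalg k).map g = dUnit A :=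
    (adj.homEquiv_unit A (dObj A) g).symm.trans
      ((adj.homEquiv A (dObj A)).apply_symm_apply _)
  have hgf : g ≫ f = 𝟙 _ := by
    apply (adj.homEquiv A _).injective
    rw [adj.homEquiv_unit, adj.homEquiv_unit, Functor.map_comp, reassoc_of% hg, hf]
    simp
  have hx' : CDGA.Hom.toAlgHom f (CDGA.Hom.toAlgHom g x) = x :=
    congrArg (fun h : D.obj A ⟶ D.obj A => CDGA.Hom.toAlgHom h x) hgf
  have h := mem_span_of_homogeneous (dObj A) dObjGen (fun g => g.2.2.length) dObjGen_mem
    (x := CDGA.Hom.toAlgHom g x) (by rw [span_dObjGen]; trivial) (CDGA.Hom.map_deg g p x hx)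
  rw [← hx']
  have h2 := Submodule.mem_map_of_mem (f := (CDGA.Hom.toAlgHom f).toLinearMap) h
  rw [Submodule.map_span] at h2
  refine Submodule.span_mono ?_ h2
  rintro _ ⟨_, ⟨⟨n, a, fs⟩, hl, rfl⟩, rfl⟩
  refine ⟨n, a, fs, hl, ?_⟩
  rw [← hf, coeff_evalAt_comp, ← coeff_dUnit ⟨n, a, fs⟩]
  rfl

/-! ### The cdga `k` -/

section Base

/-- The grading of `k` that is concentrated in degree zero. -/
def baseDeg (k : Type u) [Field k] (n : ℕ) : Submodule k k := if n = 0 then ⊤ else ⊥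

lemma mem_baseDeg_zero (x : k) : x ∈ baseDeg k 0 := by simp [baseDeg]

lemma eq_zero_of_mem_baseDeg {n : ℕ} (hn : n ≠ 0) {x : k} (hx : x ∈ baseDeg k n) : x = 0 := by
  simpa [baseDeg, hn] using hx

instance : GradedAlgebra (baseDeg k) where
  one_mem := mem_baseDeg_zero 1
  mul_mem a b x y hx hy := by
    by_cases ha : a = 0
    · by_cases hb : b = 0
      · subst ha hb; exact mem_baseDeg_zero _
      · rw [eq_zero_of_mem_baseDeg hb hy, mul_zero]; exact zero_mem _
    · rw [eq_zero_of_mem_baseDeg ha hx, zero_mul]; exact zero_mem _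
  decompose' x := DirectSum.of (fun n => baseDeg k n) 0 ⟨x, mem_baseDeg_zero x⟩
  left_inv x := by simp
  right_inv x := by
    induction x using DirectSum.induction_on with
    | zero =>
      rw [map_zero]
      exact map_zero (DirectSum.of (fun n => baseDeg k n) 0)
    | of n x =>
      rw [DirectSum.coeAddMonoidHom_of]
      by_cases hn : n = 0
      · subst hn; rfl
      · obtain ⟨x, hx⟩ := x
        obtain rfl := eq_zero_of_mem_baseDeg hn hx
        have h0 : (⟨0, hx⟩ : baseDeg k n) = 0 := rfl
        rw [h0, map_zero]
        exact map_zero (DirectSum.of (fun n => baseDeg k n) 0)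
    | add x y h1 h2 =>
      rw [map_add]
      conv_rhs => rw [← h1, ← h2]
      exact map_add (DirectSum.of (fun n => baseDeg k n) 0) ⟨_, mem_baseDeg_zero _⟩
        ⟨_, mem_baseDeg_zero _⟩

/-- The field `k` as a cdga. -/
def CDGA.base (k : Type u) [Field k] : CDGA k where
  carrier := k
  deg := baseDeg k
  d := 0
  d_mem _ _ _ := zero_mem _
  d_d _ := rfl
  leibniz _ _ _ _ := by simp
  comm m n x y hx hy := by
    by_cases hm : m = 0
    · subst hm; simp [mul_comm]
    · rw [eq_zero_of_mem_baseDeg hm hx]; simp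

/-- The isomorphism of `k` with `A⁰` for a reduced cosimplicial algebra. -/
def zeroEquiv (A : CosimpAlg k) (hA : A.IsReduced) : k ≃ₐ[k] A.obj (SimplexCategory.mk 0) :=
  AlgEquiv.ofBijective (Algebra.ofId k (A.obj (SimplexCategory.mk 0))) (by exact hA)

/-- The augmentation `A ⟶ K(k)` of a reduced cosimplicial algebra. -/
def augmentation (A : CosimpAlg k) (hA : A.IsReduced) : A ⟶ (Kalg k).obj (CDGA.base k) where
  app n := CommAlgCat.ofHom ((Algebra.ofId k _).comp
    ((zeroEquiv A hA).symm.toAlgHom.comp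
      (A.map (SimplexCategory.isTerminalZero.from n)).hom))
  naturality m n α := by
    refine CommAlgCat.hom_ext (AlgHom.ext fun a => ?_)
    have h : (A.map (SimplexCategory.isTerminalZero.from n)).hom ((A.map α).hom a) =
        (A.map (SimplexCategory.isTerminalZero.from m)).hom a := by
      rw [← AlgHom.comp_apply, ← CommAlgCat.hom_comp, ← A.map_comp]
      congr 3
    change algebraMap k _ ((zeroEquiv A hA).symm
      ((A.map (SimplexCategory.isTerminalZero.from n)).hom ((A.map α).hom a))) = _
    rw [h]
    exact (AlgHom.commutes (kMap (𝟙 (CDGA.base k)) α) _).symm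

end Base

/-! ### Reducedness and finiteness of `D(A)` -/

section Finiteness

variable {A : CosimpAlg k}

/-- The empty coefficient is unchanged by the map to `[0]`, and there `a` becomes a scalar because
`A⁰ = k`. -/
lemma coeff_nil_evalAt (hA : A.IsReduced) {C : CDGA k} (φ : A ⟶ (Kalg k).obj C)
    {n : SimplexCategory} (a : A.obj n) :
    ∃ r : k, coeff [] (evalAt φ a : TensorLam C n) = r • 1 := by
  obtain ⟨r, hr⟩ := hA.2 ((A.map (SimplexCategory.isTerminalZero.from n)).hom a)
  refine ⟨r, ?_⟩
  have h := evalAt_map φ (SimplexCategory.isTerminalZero.from n) a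
  have h' := coeff_tensorMap (𝟙 C) (SimplexCategory.isTerminalZero.from n) []
    (evalAt φ a : TensorLam C n)
  rw [← h, ← hr] at h'
  refine h'.symm.trans ?_
  have h2 : (evalAt φ (algebraMap k (A.obj (SimplexCategory.mk 0)) r) :
      TensorLam C (SimplexCategory.mk 0)) = r • tm C (SimplexCategory.mk 0) 1 1 :=
    (congrArg Subtype.val ((φ.app (SimplexCategory.mk 0)).hom.commutes r)).trans
      (Algebra.algebraMap_eq_smul_one r)
  rw [h2, map_smul, coeff_tm, iterContr_nil, map_one, one_smul]

/-- The augmentation of `A` corresponds to a morphism from `D(A)` to `k`, which keeps the scalars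
from collapsing. Degree zero is spanned by empty coefficients, which are scalars. -/
lemma isReduced_of_adj [CharZero k] {D : CosimpAlg k ⥤ CDGA k} (adj : D ⊣ Kalg k)
    (hA : A.IsReduced) : (D.obj A).IsReduced := by
  constructor
  · let f : D.obj A ⟶ CDGA.base k := (adj.homEquiv A _).symm (augmentation A hA)
    intro r s hrs
    have h := congrArg (CDGA.Hom.toAlgHom f) hrs
    rw [AlgHom.commutes, AlgHom.commutes] at h
    exact h
  · intro x hx
    have h := deg_le_span_coeff adj A 0 hx
    have h2 : x ∈ (1 : Submodule k (D.obj A).carrier) := by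
      refine Submodule.span_le.mpr ?_ h
      rintro _ ⟨n, a, fs, hl, rfl⟩
      obtain rfl := List.length_eq_zero_iff.mp hl
      obtain ⟨r, hr⟩ := coeff_nil_evalAt hA (adj.unit.app A) a
      rw [hr]
      exact Submodule.mem_one.mpr ⟨r, Algebra.algebraMap_eq_smul_one r⟩
    exact Submodule.mem_one.mp h2

lemma countP_lt_countP_le {N : ℕ} {i : Fin N} {s : List (Fin N)} (hi : i ∈ s) :
    s.countP (· < i) < s.countP (· ≤ i) := by
  induction s with
  | nil => simp at hi
  | cons j s ih =>
    have hle : s.countP (· < i) ≤ s.countP (· ≤ i) :=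
      List.countP_mono_left fun x _ h => by simpa using (by simpa using h : x < i).le
    rw [List.countP_cons, List.countP_cons]
    rcases List.mem_cons.mp hi with rfl | hi
    · simp; omega
    · have h := ih hi
      by_cases h1 : j < i
      · simp [h1, h1.le]; exact h
      · simp [h1]; omega

/-- A map `[n] → [2p]` that separates the members of a list of length `p` from all other
vertices. -/
def separate {n : SimplexCategory} (s : List (Fin (n.len + 1))) :
    n ⟶ SimplexCategory.mk (2 * s.length) :=
  SimplexCategory.Hom.mk
    -- A vertex outside the list gets twice the number of smaller entries. For an entry the second
    -- count exceeds the first, so its value lies strictly between those of all smaller and all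
    -- larger vertices. Both counts are at most the length, whence the target `[2p]`.
    ⟨fun j => ⟨s.countP (· < j) + s.countP (· ≤ j), by
        have h1 := List.countP_le_length (l := s) (p := fun x => decide (x < j))
        have h2 := List.countP_le_length (l := s) (p := fun x => decide (x ≤ j))
        change _ < 2 * s.length + 1
        omega⟩,
      fun i j hij => Nat.add_le_add
        (List.countP_mono_left fun x _ h => by
          simpa using (by simpa using h : x < i).trans_le hij)
        (List.countP_mono_left fun x _ h => by
          simpa using (by simpa using h : x ≤ i).trans hij)⟩

lemma separate_inj {n : SimplexCategory} {s : List (Fin (n.len + 1))} {i j : Fin (n.len + 1)}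
    (hi : i ∈ s) (h : (separate s).toOrderHom j = (separate s).toOrderHom i) : j = i := by
  have h' : s.countP (· < j) + s.countP (· ≤ j) = s.countP (· < i) + s.countP (· ≤ i) :=
    congrArg Fin.val h
  have h0 := countP_lt_countP_le hi
  rcases lt_trichotomy j i with hlt | rfl | hlt
  · have h1 : s.countP (· ≤ j) ≤ s.countP (· < i) :=
      List.countP_mono_left fun x _ h => by simpa using (by simpa using h : x ≤ j).trans_lt hlt
    have h2 : s.countP (· < j) ≤ s.countP (· < i) :=
      List.countP_mono_left fun x _ h => by simpa using (by simpa using h : x < j).trans hlt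
    omega
  · rfl
  · have h1 : s.countP (· ≤ i) ≤ s.countP (· < j) :=
      List.countP_mono_left fun x _ h => by simpa using (by simpa using h : x ≤ i).trans_lt hlt
    have h2 : s.countP (· ≤ i) ≤ s.countP (· ≤ j) :=
      List.countP_mono_left fun x _ h => by simpa using (by simpa using h : x ≤ i).trans hlt.le
    omega

/-- No other vertex shares the image of `i`, so its coordinate functional pulls back without extra
terms. -/
lemma pullDual_separate {n : SimplexCategory} {s : List (Fin (n.len + 1))} {i : Fin (n.len + 1)}
    (hi : i ∈ s) :
    pullDual (separate s) (coordDual k ((separate s).toOrderHom i)) = coordDual k i := by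
  refine Finsupp.lhom_ext' fun j => LinearMap.ext_ring ?_
  simp only [pullDual, coordDual, LinearMap.comp_apply, Finsupp.lmapDomain_apply,
    Finsupp.lsingle_apply, Finsupp.mapDomain_single, Finsupp.lapply_apply]
  by_cases h : j = i
  · subst h; simp
  · rw [Finsupp.single_eq_of_ne (Ne.symm h), Finsupp.single_eq_of_ne]
    exact fun h' => h (separate_inj hi h'.symm)

/-- This bounds the cosimplicial degree: however large `n` is, a coefficient of length `p` along
generators already occurs over `[2p]`. -/
lemma coeff_coordDual_eq {C : CDGA k} (φ : A ⟶ (Kalg k).obj C) {n : SimplexCategory}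
    (s : List (Fin (n.len + 1))) (a : A.obj n) :
    coeff (s.map (coordDual k)) (evalAt φ a : TensorLam C n) =
      coeff ((s.map (separate s).toOrderHom).map (coordDual k))
        (evalAt φ ((A.map (separate s)).hom a) :
          TensorLam C (SimplexCategory.mk (2 * s.length))) := by
  rw [evalAt_map, coeff_tensorMap, List.map_map, List.map_map]
  have : s.map (coordDual k) = s.map (pullDual (separate s) ∘ coordDual k ∘
      (separate s).toOrderHom) :=
    List.map_congr_left fun i hi => (pullDual_separate hi).symm
  exact congrArg (fun l => coeff l (evalAt φ a : TensorLam C n)) this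

/-- The linear map `Aⁿ → C` given by a coefficient. -/
def coeffMap {C : CDGA k} (φ : A ⟶ (Kalg k).obj C) {n : SimplexCategory}
    (fs : List (LamDual k n)) : A.obj n →ₗ[k] C.carrier :=
  coeff fs ∘ₗ (kSubalgebra C n).val.toLinearMap ∘ₗ (φ.app n).hom.toLinearMap

/-- Expand along generators; only lists of the same length as `fs` survive the contraction, and each
of these moves to `[2p]`. -/
lemma coeff_mem_span_coord [CharZero k] {C : CDGA k} (φ : A ⟶ (Kalg k).obj C)
    {n : SimplexCategory} (fs : List (LamDual k n)) (a : A.obj n) :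
    coeff fs (evalAt φ a : TensorLam C n) ∈
      ⨆ t : {t : List (Fin (2 * fs.length + 1)) | t.length = fs.length},
        LinearMap.range (coeffMap φ (n := SimplexCategory.mk (2 * fs.length))
          (t.1.map (coordDual k))) := by
  obtain ⟨J, _, s, w, -, hw, hx⟩ := exists_tensor_expansion (k := k) n
  rw [hx C (evalAt φ a : TensorLam C n), map_sum]
  refine Submodule.sum_mem _ fun j _ => ?_
  rw [coeff_tm]
  by_cases hj : (s j).length = fs.length
  · refine Submodule.smul_mem _ _ ?_
    -- The simplex `[2p]` in the goal depends on this length, which must become a variable before it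
    -- can be identified with the length of `s j`.
    generalize fs.length = N at hj
    subst hj
    rw [coeff_coordDual_eq]
    exact Submodule.mem_iSup_of_mem ⟨(s j).map (separate (s j)).toOrderHom, by simp⟩ ⟨_, rfl⟩
  · rw [iterContr_of_mem fs (hw j) hj, zero_smul]
    exact zero_mem _

lemma evalAt_augIdeal_pow {C : CDGA k} (φ : A ⟶ (Kalg k).obj C) {n : SimplexCategory} {j : ℕ}
    {a : A.obj n} (ha : a ∈ augIdeal A n ^ j) :
    evalAt φ a ∈ augIdeal ((Kalg k).obj C) n ^ j :=
  ((Ideal.pow_right_mono (augIdeal_app φ n) j).trans (Ideal.le_comap_pow _ j)) ha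

/-- Modulo a power of a finitely generated ideal of codimension one, an algebra is
finite-dimensional. -/
lemma exists_fg_complement_pow {R : Type*} [CommRing R] [Algebra k R] {I : Ideal R} (hI : I.FG)
    (h : ∀ x : R, ∃ r : k, x - algebraMap k R r ∈ I) (j : ℕ) :
    ∃ V : Submodule k R, V.FG ∧ ∀ x, ∃ v ∈ V, x - v ∈ I ^ j := by
  obtain ⟨S, hS⟩ := hI
  induction j with
  | zero => exact ⟨⊥, Submodule.fg_bot, fun x => ⟨0, zero_mem _, by simp⟩⟩
  | succ j ih =>
    obtain ⟨V, hV, hx⟩ := ih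
    -- An element is a scalar plus a combination of the generators in `S`; reducing the multipliers
    -- modulo `I ^ j` to `V` changes it by an element of `I ^ (j + 1)`.
    refine ⟨1 ⊔ V * Submodule.span k (S : Set R), ?_, fun x => ?_⟩
    · refine Submodule.FG.sup ?_ (hV.mul ⟨S, rfl⟩)
      rw [Submodule.one_eq_span]
      exact Submodule.fg_span_singleton 1
    · have key : ∀ y ∈ I, ∀ a, ∃ v ∈ V * Submodule.span k (S : Set R), a * y - v ∈ I ^ (j + 1) := by
        intro y hy
        rw [← hS] at hy
        induction hy using Submodule.span_induction with
        | mem y hy =>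
          intro a
          obtain ⟨v, hv, hav⟩ := hx a
          refine ⟨v * y, Submodule.mul_mem_mul hv (Submodule.subset_span hy), ?_⟩
          rw [← sub_mul, pow_succ]
          refine Ideal.mul_mem_mul hav ?_
          rw [← hS]
          exact Ideal.subset_span hy
        | zero => exact fun a => ⟨0, zero_mem _, by simp⟩
        | add y z _ _ h1 h2 =>
          intro a
          obtain ⟨v, hv, hv'⟩ := h1 a
          obtain ⟨w, hw, hw'⟩ := h2 a
          refine ⟨v + w, add_mem hv hw, ?_⟩
          have : a * (y + z) - (v + w) = (a * y - v) + (a * z - w) := by ring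
          rw [this]
          exact add_mem hv' hw'
        | smul b y _ h1 =>
          intro a
          obtain ⟨v, hv, hv'⟩ := h1 (a * b)
          exact ⟨v, hv, by rwa [smul_eq_mul, ← mul_assoc]⟩
      obtain ⟨r, hr⟩ := h x
      obtain ⟨v, hv, hv'⟩ := key _ hr 1
      refine ⟨algebraMap k R r + v, Submodule.add_mem_sup
        (Submodule.mem_one.mpr ⟨r, rfl⟩) hv, ?_⟩
      rwa [one_mul, sub_sub] at hv'

lemma sub_algebraMap_mem_augIdeal (hA : A.IsReduced) {n : SimplexCategory} (x : A.obj n) :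
    ∃ r : k, x - algebraMap k (A.obj n) r ∈ augIdeal A n := by
  obtain ⟨r, hr⟩ := hA.2 ((A.map (SimplexCategory.isTerminalZero.from n)).hom x)
  refine ⟨r, ?_⟩
  change (A.map (SimplexCategory.isTerminalZero.from n)).hom _ = 0
  rw [map_sub, AlgHom.commutes, sub_eq_zero]
  exact hr.symm

/-- A coefficient of length `p` kills `𝔪^(p+1)`, hence factors through a finite-dimensional
quotient. -/
lemma finiteDimensional_range_coeffMap [CharZero k] (hA : A.IsReduced) {n : SimplexCategory}
    (hm : (augIdeal A n).FG) {C : CDGA k} (φ : A ⟶ (Kalg k).obj C) (fs : List (LamDual k n)) :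
    FiniteDimensional k (LinearMap.range (coeffMap φ fs)) := by
  obtain ⟨V, hV, hx⟩ := exists_fg_complement_pow hm (sub_algebraMap_mem_augIdeal hA)
    (fs.length + 1)
  have : LinearMap.range (coeffMap φ fs) = V.map (coeffMap φ fs) := by
    refine le_antisymm ?_ (LinearMap.map_le_range)
    rintro _ ⟨x, rfl⟩
    obtain ⟨v, hv, hxv⟩ := hx x
    refine ⟨v, hv, ?_⟩
    rw [eq_comm, ← sub_eq_zero, ← map_sub]
    exact coeff_of_mem_augIdeal_pow fs (Nat.lt_succ_self _) (evalAt_augIdeal_pow φ hxv)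
  rw [this]
  exact Module.Finite.iff_fg.mpr (hV.map _)

/-- Degree `p` lies in a sum of finite-dimensional ranges indexed by the finitely many lists of `p`
vertices of `[2p]`. Asking only for finitely generated ideals covers both finitely generated
algebras and complete Noetherian ones. -/
lemma reducedFGCDGA_of_adj [CharZero k] {D : CosimpAlg k ⥤ CDGA k} (adj : D ⊣ Kalg k)
    (hA : reducedFGIdeal k A) : reducedFGCDGA k (D.obj A) := by
  refine ⟨isReduced_of_adj adj hA.1, fun p _ => ?_⟩
  have : Finite {t : List (Fin (2 * p + 1)) | t.length = p} := List.finite_length_eq _ p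
  let W : Submodule k (D.obj A).carrier :=
    ⨆ t : {t : List (Fin (2 * p + 1)) | t.length = p},
      LinearMap.range (coeffMap (adj.unit.app A) (n := SimplexCategory.mk (2 * p))
        (t.1.map (coordDual k)))
  have hW : FiniteDimensional k W := by
    have := fun t : {t : List (Fin (2 * p + 1)) | t.length = p} =>
      finiteDimensional_range_coeffMap hA.1 (hA.2 (SimplexCategory.mk (2 * p))) (adj.unit.app A)
        (t.1.map (coordDual k))
    exact Submodule.finiteDimensional_iSup _
  have hle : (D.obj A).deg p ≤ W := by
    refine (deg_le_span_coeff adj A p).trans (Submodule.span_le.mpr ?_)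
    rintro _ ⟨n, a, fs, rfl, rfl⟩
    exact coeff_mem_span_coord _ _ _
  exact Submodule.finiteDimensional_of_le hle

end Finiteness

/-! ### Complete local algebras -/

section CompleteLocal

variable {R : Type u} [CommRing R] [Algebra k R] {I : Ideal R}

lemma isAdicComplete_of_pow_eq_bot {N : ℕ} (h : I ^ N = ⊥) : IsAdicComplete I R where
  haus' x hx := by
    have := hx N
    rwa [h, Submodule.bot_smul, SModEq.bot] at this
  prec' f hf := by
    refine ⟨f N, fun n => ?_⟩
    rcases le_total n N with hn | hn
    · exact hf hn
    · have h1 := hf hn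
      rw [h, Submodule.bot_smul, SModEq.bot] at h1
      rw [h1]

/-- A proper ideal that together with the scalars fills the ring is maximal, and completeness along
a maximal ideal forces the ring to be local. -/
lemma isCompleteLocalNoetherian_of_isAdicComplete [IsNoetherianRing R] (hc : IsAdicComplete I R)
    (hI : I ≠ ⊤) (h : ∀ x : R, ∃ r : k, x - algebraMap k R r ∈ I) :
    IsCompleteLocalNoetherian k R := by
  have hmax : I.IsMaximal := by
    refine Ideal.isMaximal_iff.mpr ⟨fun h1 => hI ((Ideal.eq_top_iff_one I).mpr h1),
      fun J x hIJ hx hxJ => ?_⟩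
    obtain ⟨r, hr⟩ := h x
    have hr0 : r ≠ 0 := by
      rintro rfl
      rw [map_zero, sub_zero] at hr
      exact hx hr
    have h1 : algebraMap k R r ∈ J := by
      have := J.sub_mem hxJ (hIJ hr)
      rwa [sub_sub_cancel] at this
    have h2 := J.mul_mem_left (algebraMap k R r⁻¹) h1
    rwa [← map_mul, inv_mul_cancel₀ hr0, map_one] at h2
  have hloc : IsLocalRing R := isLocalRing_of_isAdicComplete_maximal I
  have hm : IsLocalRing.maximalIdeal R = I := (IsLocalRing.eq_maximalIdeal hmax).symm
  refine ⟨hloc, inferInstance, by rw [hm]; exact hc, (algebraMap k _).injective, fun y => ?_⟩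
  obtain ⟨x, rfl⟩ := IsLocalRing.residue_surjective y
  obtain ⟨r, hr⟩ := h x
  refine ⟨r, ?_⟩
  rw [IsScalarTower.algebraMap_apply k R (IsLocalRing.ResidueField R)]
  refine (Ideal.Quotient.eq.mpr ?_).symm
  rwa [hm]

end CompleteLocal

lemma augIdeal_ne_top {A : CosimpAlg k} (hA : A.IsReduced) (n : SimplexCategory) :
    augIdeal A n ≠ ⊤ := by
  intro h
  have h1 : (1 : A.obj n) ∈ augIdeal A n := by rw [h]; trivial
  have h2 : (A.map (SimplexCategory.isTerminalZero.from n)).hom 1 = 0 := h1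
  rw [map_one] at h2
  have h3 : algebraMap k (A.obj (SimplexCategory.mk 0)) 1 = algebraMap k _ 0 := by
    rw [map_one, map_zero]; exact h2
  exact one_ne_zero (hA.1 h3)

/-! ### The values of `K` at reduced cdgas -/

section KValues

variable {C : CDGA k}

/-- With a single generator only lists of length at most one matter. Every functional is then a
multiple of `lamFunctional`, whose coefficient is `d` of the empty one. -/
lemma kSubalgebra_zero_ext [CharZero k] (t : kSubalgebra C (SimplexCategory.mk 0))
    (h : coeff [] (t : TensorLam C (SimplexCategory.mk 0)) = 0) : t = 0 := by
  refine Subtype.ext (tensor_ext fun fs hfs => ?_)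
  refine Eq.trans ?_ (map_zero _).symm
  match fs, hfs with
  | [], _ => exact h
  | [f], _ =>
    have hf : f = f (Finsupp.single 0 1) • lamFunctional k (SimplexCategory.mk 0) := by
      refine Finsupp.lhom_ext' fun i => LinearMap.ext_ring ?_
      obtain rfl : i = 0 := Subsingleton.elim (α := Fin 1) _ _
      simp [lamFunctional]
    have h1 : iterContr [f] = f (Finsupp.single 0 1) •
        iterContr [lamFunctional k (SimplexCategory.mk 0)] := by
      refine LinearMap.ext fun x => ?_
      rw [LinearMap.smul_apply, iterContr_cons, iterContr_cons]
      conv_lhs => rw [hf]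
      rw [contr, map_smul, LinearMap.smul_apply, map_smul]
      rfl
    have h2 : coeff [f] = f (Finsupp.single 0 1) •
        coeff (C := C) [lamFunctional k (SimplexCategory.mk 0)] := by
      refine tensorLam_hom_ext fun a x => ?_
      rw [LinearMap.smul_apply, coeff_tm, coeff_tm, h1, LinearMap.smul_apply, smul_assoc]
    have h3 := d_coeff [] t
    rw [h, map_zero, List.length_nil, pow_zero, one_smul] at h3
    rw [h2, LinearMap.smul_apply, ← h3, smul_zero]

lemma coeff_algebraMap {n : SimplexCategory} (r : k) :
    coeff [] ((algebraMap k (kSubalgebra C n) r : kSubalgebra C n) : TensorLam C n) =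
      algebraMap k C.carrier r := by
  have h2 : ((algebraMap k (kSubalgebra C n) r : kSubalgebra C n) : TensorLam C n) =
      r • tm C n 1 1 := Algebra.algebraMap_eq_smul_one r
  rw [h2, map_smul, coeff_tm, iterContr_nil, map_one, one_smul, Algebra.algebraMap_eq_smul_one]

lemma isReduced_Kalg [CharZero k] (hC : C.IsReduced) : ((Kalg k).obj C).IsReduced := by
  constructor
  · intro r s hrs
    refine hC.1 ?_
    rw [← coeff_algebraMap (n := SimplexCategory.mk 0), ← coeff_algebraMap]
    exact congrArg (fun t : kSubalgebra C (SimplexCategory.mk 0) =>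
      coeff [] (t : TensorLam C (SimplexCategory.mk 0))) hrs
  · intro t
    obtain ⟨r, hr⟩ := hC.2 _ (coeff_mem [] (Subtype.prop (p := (· ∈ kSubalgebra C _)) t).1)
    refine ⟨r, sub_eq_zero.mp (kSubalgebra_zero_ext _ ?_)⟩
    change coeff [] (((algebraMap k (kSubalgebra C (SimplexCategory.mk 0)) r :
      kSubalgebra C (SimplexCategory.mk 0)) : TensorLam C (SimplexCategory.mk 0)) - t.1) = 0
    rw [map_sub, coeff_algebraMap]
    exact sub_eq_zero.mpr hr

lemma finiteDimensional_deg (hC : reducedFGCDGA k C) (i : ℕ) : FiniteDimensional k (C.deg i) := by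
  rcases Nat.eq_zero_or_pos i with rfl | hi
  · have hle : C.deg 0 ≤ 1 := fun x hx => Submodule.mem_one.mpr (hC.1.2 x hx)
    have : FiniteDimensional k (1 : Submodule k C.carrier) := by
      rw [Submodule.one_eq_span]; infer_instance
    exact Submodule.finiteDimensional_of_le hle
  · exact hC.2 i hi

/-- The finitely many coefficients of the expansion embed the algebra in a finite product of graded
pieces of `C`. -/
lemma finiteDimensional_kSubalgebra [CharZero k] (hC : reducedFGCDGA k C) (n : SimplexCategory) :
    FiniteDimensional k (kSubalgebra C n) := by
  obtain ⟨J, _, s, w, -, hw, hx⟩ := exists_tensor_expansion (k := k) n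
  have := finiteDimensional_deg hC
  let f : kSubalgebra C n →ₗ[k] ∀ j, C.deg ((s j).map (coordDual k)).length :=
    LinearMap.pi fun j => LinearMap.codRestrict _
      (coeff ((s j).map (coordDual k)) ∘ₗ (kSubalgebra C n).val.toLinearMap)
      fun t => coeff_mem _ t.2.1
  refine FiniteDimensional.of_injective f fun a b hab => Subtype.ext ?_
  rw [hx C a, hx C b]
  refine Finset.sum_congr rfl fun j _ => ?_
  have h : coeff ((s j).map (coordDual k)) (a : TensorLam C n) =
    coeff ((s j).map (coordDual k)) (b : TensorLam C n) := congrArg Subtype.val (congrFun hab j)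
  rw [h]

lemma reducedFG_Kalg [CharZero k] (hC : reducedFGCDGA k C) : reducedFG k ((Kalg k).obj C) := by
  refine ⟨isReduced_Kalg hC.1, fun n => ?_⟩
  have := finiteDimensional_kSubalgebra hC n
  exact (inferInstance : Algebra.FiniteType k (kSubalgebra C n))

lemma isAdicComplete_Kalg [CharZero k] (C : CDGA k) (n : SimplexCategory) :
    IsAdicComplete (augIdeal ((Kalg k).obj C) n) (((Kalg k).obj C).obj n) :=
  isAdicComplete_of_pow_eq_bot (augIdeal_Kalg_pow C n)

lemma reducedComplete_Kalg [CharZero k] (hC : reducedFGCDGA k C) :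
    reducedComplete k ((Kalg k).obj C) := by
  refine ⟨isReduced_Kalg hC.1, fun n => ?_⟩
  have h1 : Algebra.FiniteType k (((Kalg k).obj C).obj n) := (reducedFG_Kalg hC).2 n
  have h2 : IsNoetherianRing (((Kalg k).obj C).obj n) := Algebra.FiniteType.isNoetherianRing k _
  exact isCompleteLocalNoetherian_of_isAdicComplete (isAdicComplete_Kalg C n)
    (augIdeal_ne_top (isReduced_Kalg hC.1) n) (sub_algebraMap_mem_augIdeal (isReduced_Kalg hC.1))

end KValues

/-! ### Completions of reduced cosimplicial algebras -/

section Completions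

lemma reducedFGIdeal_of_reducedFG {A : CosimpAlg k} (hA : reducedFG k A) : reducedFGIdeal k A := by
  refine ⟨hA.1, fun n => ?_⟩
  have := hA.2 n
  have : IsNoetherianRing (A.obj n) := Algebra.FiniteType.isNoetherianRing k _
  exact IsNoetherian.noetherian _

lemma reducedFGIdeal_of_reducedComplete {A : CosimpAlg k} (hA : reducedComplete k A) :
    reducedFGIdeal k A := by
  refine ⟨hA.1, fun n => ?_⟩
  have := (hA.2 n).isNoetherianRing
  exact IsNoetherian.noetherian _

variable {A : CosimpAlg k}

lemma augIdeal_zero (A : CosimpAlg k) : augIdeal A (SimplexCategory.mk 0) = ⊥ := by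
  refine (Submodule.eq_bot_iff _).mpr fun x hx => ?_
  have h : (A.map (SimplexCategory.isTerminalZero.from (SimplexCategory.mk 0))).hom x = 0 := hx
  rw [SimplexCategory.isTerminalZero.hom_ext (SimplexCategory.isTerminalZero.from _) (𝟙 _),
    A.map_id] at h
  exact h

lemma algebraMap_completion_bijective {R : Type u} [CommRing R] {I : Ideal R}
    (h : IsAdicComplete I R) : Function.Bijective (algebraMap R (AdicCompletion I R)) :=
  AdicCompletion.of_bijective_iff.mpr h

/-- In cosimplicial degree zero the ideal is zero, so completing changes nothing. -/
lemma isReduced_completion (hA : A.IsReduced) : ((completion k).obj A).IsReduced := by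
  have h : Function.Bijective (algebraMap (A.obj (SimplexCategory.mk 0))
      (AdicCompletion (augIdeal A (SimplexCategory.mk 0)) (A.obj (SimplexCategory.mk 0)))) :=
    algebraMap_completion_bijective (by rw [augIdeal_zero]; infer_instance)
  have h2 := h.comp hA
  rw [← RingHom.coe_comp, ← IsScalarTower.algebraMap_eq] at h2
  exact h2

/-- The target is completed along the zero ideal, so vanishing is visible at stage one; the later
terms of a Cauchy sequence agree with its first term modulo `𝔪`. -/
lemma mem_augIdeal_completion (n : SimplexCategory)
    (x : AdicCompletion (augIdeal A n) (A.obj n)) :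
    x ∈ augIdeal ((completion k).obj A) n ↔ AdicCompletion.evalₐ (augIdeal A n) 1 x = 0 := by
  obtain ⟨c, rfl⟩ := AdicCompletion.mk_surjective (augIdeal A n) (A.obj n) x
  have hz := augIdeal_zero A
  have hdef : AdicCompletion.mk (augIdeal A n) (A.obj n) c ∈ augIdeal ((completion k).obj A) n ↔
      completionMap _ _ (A.map (SimplexCategory.isTerminalZero.from n)).hom
        (augIdeal_map A (SimplexCategory.isTerminalZero.from n))
        (AdicCompletion.mk (augIdeal A n) (A.obj n) c) = 0 := Iff.rfl
  rw [hdef, AdicCompletion.evalₐ_mk, Ideal.Quotient.eq_zero_iff_mem, pow_one]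
  constructor
  · intro h
    have h1 := eval_completionMap (A.map (SimplexCategory.isTerminalZero.from n)).hom
      (augIdeal_map A (SimplexCategory.isTerminalZero.from n)) 1 c
    rw [h, map_zero, eq_comm, Ideal.Quotient.eq_zero_iff_mem, pow_one, augIdeal_zero] at h1
    exact h1
  · intro h
    refine AdicCompletion.ext_evalₐ fun i => ?_
    rw [eval_completionMap, map_zero, Ideal.Quotient.eq_zero_iff_mem]
    -- Stage zero is the quotient by the unit ideal and carries no condition.
    rcases Nat.eq_zero_or_pos i with rfl | hi
    · simp
    · have hc := AdicCompletion.Ideal.mk_eq_mk (augIdeal A n) hi c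
      rw [Ideal.Quotient.eq, pow_one] at hc
      have hci : c.val i ∈ augIdeal A n := by
        have := (augIdeal A n).add_mem hc h
        rwa [sub_add_cancel] at this
      have h0 : (A.map (SimplexCategory.isTerminalZero.from n)).hom (c.val i) = 0 := hci
      rw [h0]
      exact zero_mem _

lemma augIdeal_completion {n : SimplexCategory} (hm : (augIdeal A n).FG) :
    augIdeal ((completion k).obj A) n = (augIdeal A n).map
      (algebraMap (A.obj n) (AdicCompletion (augIdeal A n) (A.obj n))) := by
  rw [← AdicCompletion.ker_evalOneₐ_eq_map _ hm]
  ext x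
  refine (mem_augIdeal_completion n x).trans
    (Iff.trans ?_ (Iff.rfl : AdicCompletion.evalOneₐ (augIdeal A n) x = 0 ↔ _))
  obtain ⟨c, rfl⟩ := AdicCompletion.mk_surjective (augIdeal A n) (A.obj n) x
  rw [← AdicCompletion.factorₐ_evalₐ_one, AdicCompletion.evalₐ_mk,
    Ideal.Quotient.eq_zero_iff_mem]
  have h : augIdeal A n ^ 1 = augIdeal A n := pow_one _
  exact (iff_of_eq (congrArg (c.val 1 ∈ ·) h)).trans Ideal.Quotient.eq_zero_iff_mem.symm

/-- Take the `j`-th term of a Cauchy sequence. Finite generation identifies the kernel of evaluation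
at stage `j` with the extended power of the ideal. -/
lemma exists_sub_mem_map_pow {R : Type u} [CommRing R] {I : Ideal R} (hI : I.FG) (j : ℕ)
    (x : AdicCompletion I R) : ∃ a : R, x - algebraMap R _ a ∈
      (I.map (algebraMap R (AdicCompletion I R))) ^ j := by
  obtain ⟨c, rfl⟩ := AdicCompletion.mk_surjective I R x
  refine ⟨c.val j, ?_⟩
  have h : AdicCompletion.mk I R c - algebraMap R _ (c.val j) ∈ (AdicCompletion.eval I R j).ker := by
    rw [LinearMap.mem_ker, map_sub, sub_eq_zero]
    rfl
  rw [← AdicCompletion.pow_smul_top_eq_ker_eval hI] at h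
  rw [← Ideal.map_pow]
  refine Submodule.smul_induction_on h (fun r hr y _ => ?_) fun y z hy hz => add_mem hy hz
  rw [Algebra.smul_def]
  exact Ideal.mul_mem_right _ _ (Ideal.mem_map_of_mem _ hr)

/-- The ring `R` need not be Noetherian. Generators of `I` define a map from a polynomial ring,
whose completion is a power series ring and maps onto the completion of `R`. -/
lemma isNoetherianRing_completion {R : Type u} [CommRing R] [Algebra k R] {I : Ideal R}
    (hI : I.FG) (h : ∀ x : R, ∃ r : k, x - algebraMap k R r ∈ I) :
    IsNoetherianRing (AdicCompletion I R) := by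
  obtain ⟨r, y, hy⟩ := Submodule.fg_iff_exists_fin_generating_family.mp hI
  let P := MvPolynomial (Fin r) k
  let L : Ideal P := MvPolynomial.idealOfVars (Fin r) k
  have hLI : L.map (MvPolynomial.aeval y : P →ₐ[k] R) = I := by
    change Ideal.map _ (Ideal.span (Set.range MvPolynomial.X)) = I
    rw [Ideal.map_span, ← Set.range_comp, ← hy]
    congr 2
    funext i
    simp
  have hle : L ≤ I.comap (MvPolynomial.aeval y : P →ₐ[k] R) :=
    Ideal.map_le_iff_le_comap.mp hLI.le
  let B := AdicCompletion L P
  let L' : Ideal B := L.map (algebraMap P B)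
  have hL : L.FG := MvPolynomial.idealOfVars_fg (Fin r) k
  have hB : IsAdicComplete L' B := AdicCompletion.isAdicComplete_self L hL
  have hNB : IsNoetherianRing B :=
    isNoetherianRing_of_ringEquiv _ (MvPowerSeries.toAdicCompletionAlgEquiv (Fin r) k).toRingEquiv
  let f : B →ₐ[k] AdicCompletion I R := completionMap L I (MvPolynomial.aeval y) hle
  have hmap : L'.map (f : B →+* AdicCompletion I R) = I.map (algebraMap R (AdicCompletion I R)) := by
    refine Eq.trans ?_ (congrArg (Ideal.map (algebraMap R (AdicCompletion I R))) hLI)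
    refine (Ideal.map_map _ _).trans (Eq.trans ?_ (Ideal.map_map _ _).symm)
    exact congrArg (fun φ => Ideal.map φ L)
      (RingHom.ext fun x => completionMap_of (MvPolynomial.aeval y) hle x)
  have hcR : IsAdicComplete (I.map (algebraMap R (AdicCompletion I R))) (AdicCompletion I R) :=
    AdicCompletion.isAdicComplete_self I hI
  have hH : IsHausdorff (L'.map (f : B →+* AdicCompletion I R)) (AdicCompletion I R) := by
    rw [hmap]; infer_instance
  have hsurj : Function.Surjective (f : B →+* AdicCompletion I R) := by
    -- By completeness, surjectivity need only be checked modulo the ideal, where constants already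
    -- suffice.
    refine surjective_of_mk_map_comp_surjective (I := L') _ fun z => ?_
    obtain ⟨x, rfl⟩ := Ideal.Quotient.mk_surjective z
    obtain ⟨a, ha⟩ := exists_sub_mem_map_pow hI 1 x
    obtain ⟨s, hs⟩ := h a
    refine ⟨algebraMap k B s, ?_⟩
    have hfs : (f : B →+* AdicCompletion I R) (algebraMap k B s) =
        algebraMap R (AdicCompletion I R) (algebraMap k R s) := by
      refine (f.commutes s).trans ?_
      rw [← IsScalarTower.algebraMap_apply]
    rw [RingHom.comp_apply, eq_comm, Ideal.Quotient.eq, hfs, hmap]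
    rw [pow_one] at ha
    have := add_mem ha (Ideal.mem_map_of_mem (algebraMap R (AdicCompletion I R)) hs)
    rwa [map_sub, sub_add_sub_cancel] at this
  exact isNoetherianRing_of_surjective B _ (f : B →+* AdicCompletion I R) hsurj

lemma reducedComplete_completion (hA : reducedFGIdeal k A) :
    reducedComplete k ((completion k).obj A) := by
  have hr := isReduced_completion hA.1
  refine ⟨hr, fun n => ?_⟩
  have hN : IsNoetherianRing (((completion k).obj A).obj n) :=
    isNoetherianRing_completion (hA.2 n) (sub_algebraMap_mem_augIdeal hA.1)
  refine isCompleteLocalNoetherian_of_isAdicComplete (I := augIdeal ((completion k).obj A) n) ?_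
    (augIdeal_ne_top hr n) (sub_algebraMap_mem_augIdeal hr)
  rw [augIdeal_completion (hA.2 n)]
  exact AdicCompletion.isAdicComplete_self _ (hA.2 n)

lemma isIso_toCompletion (h : ∀ n, IsAdicComplete (augIdeal A n) (A.obj n)) :
    IsIso ((toCompletion k).app A) := by
  have : ∀ n, IsIso (((toCompletion k).app A).app n) := fun n => by
    let e : A.obj n ≃ₐ[k] AdicCompletion (augIdeal A n) (A.obj n) :=
      AlgEquiv.ofBijective (IsScalarTower.toAlgHom k (A.obj n) _)
        (algebraMap_completion_bijective (h n))
    exact ⟨CommAlgCat.ofHom e.symm.toAlgHom,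
      CommAlgCat.hom_ext (AlgHom.ext fun x => e.symm_apply_apply x),
      CommAlgCat.hom_ext (AlgHom.ext fun x => e.apply_symm_apply x)⟩
  exact NatIso.isIso_of_isIso_app _

lemma isIso_toCompletion_Kalg [CharZero k] (C : CDGA k) :
    IsIso ((toCompletion k).app ((Kalg k).obj C)) :=
  isIso_toCompletion fun n => isAdicComplete_Kalg C n

/-- Injectivity: modulo a high power of the ideal every element of the completion comes from `A`,
and `K(C)` kills that power. Surjectivity: complete the morphism and invert the map from `K(C)` to
its completion. -/
lemma toCompletion_comp_bijective [CharZero k] (hA : ∀ n, (augIdeal A n).FG) (C : CDGA k) :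
    Function.Bijective fun g : (completion k).obj A ⟶ (Kalg k).obj C =>
      (toCompletion k).app A ≫ g := by
  constructor
  · intro g h hgh
    refine NatTrans.ext (funext fun n => CommAlgCat.hom_ext (AlgHom.ext fun x => ?_))
    obtain ⟨a, ha⟩ := exists_sub_mem_map_pow (hA n) (n.len + 2) x
    rw [← augIdeal_completion (hA n)] at ha
    have key : ∀ g : (completion k).obj A ⟶ (Kalg k).obj C,
        (g.app n).hom x = (((toCompletion k).app A ≫ g).app n).hom a := fun g => by
      have := ((Ideal.pow_right_mono (augIdeal_app g n) (n.len + 2)).trans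
        (Ideal.le_comap_pow _ _)) ha
      rw [augIdeal_Kalg_pow] at this
      have h0 : (g.app n).hom (x - (((toCompletion k).app A).app n).hom a) = 0 := this
      rw [map_sub, sub_eq_zero] at h0
      exact h0
    rw [key g, key h]
    exact congrArg (fun f : A ⟶ (Kalg k).obj C => (f.app n).hom a) hgh
  · intro φ
    have := isIso_toCompletion_Kalg C
    refine ⟨(completion k).map φ ≫ inv ((toCompletion k).app ((Kalg k).obj C)), ?_⟩
    exact (Category.assoc _ _ _).symm.trans
      ((IsIso.comp_inv_eq _).mpr ((toCompletion k).naturality φ).symm)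

/-- Under the adjunction, precomposition with this map becomes precomposition with `A ⟶ Â` on
morphisms to `K(C)`; conclude by Yoneda. -/
lemma isIso_map_toCompletion [CharZero k] {D : CosimpAlg k ⥤ CDGA k} (adj : D ⊣ Kalg k)
    (hA : ∀ n, (augIdeal A n).FG) : IsIso (D.map ((toCompletion k).app A)) := by
  refine isIso_of_coyoneda_map_bijective _ fun C => ?_
  have h := ((adj.homEquiv A C).symm.bijective.comp (toCompletion_comp_bijective hA C)).comp
    (adj.homEquiv ((completion k).obj A) C).bijective
  refine (iff_of_eq (congrArg _ (funext fun g => ?_))).mp h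
  change (adj.homEquiv A C).symm ((toCompletion k).app A ≫ adj.homEquiv _ C g) = _
  rw [Equiv.symm_apply_eq]
  exact (adj.homEquiv_naturality_left _ _).symm

end Completions

/-! ### Restriction of adjunctions to full subcategories -/

lemma exists_restrict_adjunction {X Y : Type*} [Category X] [Category Y] {P : ObjectProperty X}
    {Q : ObjectProperty Y} {F : X ⥤ Y} {G : Y ⥤ X} (adj : F ⊣ G) (hF : ∀ A, P A → Q (F.obj A))
    (hG : ∀ C, Q C → P (G.obj C)) :
    ∃ adj' : restrict F hF ⊣ restrict G hG,
      (∀ A, (adj'.unit.app A).hom = adj.unit.app A.obj) ∧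
      (∀ C, (adj'.counit.app C).hom = adj.counit.app C.obj) :=
  ⟨{  unit :=
        { app := fun A => ObjectProperty.homMk (adj.unit.app A.obj)
          naturality := fun _ _ f => ObjectProperty.hom_ext _ (adj.unit.naturality f.hom) }
      counit :=
        { app := fun C => ObjectProperty.homMk (adj.counit.app C.obj)
          naturality := fun _ _ f => ObjectProperty.hom_ext _ (adj.counit.naturality f.hom) }
      left_triangle_components := fun A =>
        ObjectProperty.hom_ext _ (adj.left_triangle_components A.obj)
      right_triangle_components := fun C =>
        ObjectProperty.hom_ext _ (adj.right_triangle_components C.obj) },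
    fun _ => rfl, fun _ => rfl⟩

lemma exists_iso_of_isIso_app {X Y : Type*} [Category X] [Category Y] {F G : X ⥤ Y}
    (τ : G ⟶ F) (h : ∀ A, IsIso (τ.app A)) :
    ∃ e : F ≅ G, ∀ A, e.inv.app A = τ.app A :=
  have := NatIso.isIso_of_isIso_app τ
  ⟨(asIso τ).symm, fun _ => rfl⟩

lemma isIso_of_isIso_hom {Y : Type*} [Category Y] {Q : ObjectProperty Y} {A B : Q.FullSubcategory}
    (f : A ⟶ B) (h : IsIso f.hom) : IsIso f :=
  ⟨ObjectProperty.homMk (inv f.hom), ObjectProperty.hom_ext _ (IsIso.hom_inv_id f.hom),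
    ObjectProperty.hom_ext _ (IsIso.inv_hom_id f.hom)⟩

lemma exists_restrict_iso {X Y Z : Type*} [Category X] [Category Y] [Category Z]
    {P : ObjectProperty X} {Q : ObjectProperty Y} {R : ObjectProperty Z} {F : X ⥤ Y} {G : Y ⥤ Z}
    {H : X ⥤ Z} (hF : ∀ A, P A → Q (F.obj A)) (hG : ∀ A, Q A → R (G.obj A))
    (hH : ∀ A, P A → R (H.obj A)) (τ : H ⟶ F ⋙ G) (h : ∀ A, P A → IsIso (τ.app A)) :
    ∃ e : restrict F hF ⋙ restrict G hG ≅ restrict H hH,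
      ∀ A, (e.inv.app A).hom = τ.app A.obj := by
  let σ : restrict H hH ⟶ restrict F hF ⋙ restrict G hG :=
    { app := fun A => ObjectProperty.homMk (τ.app A.obj)
      naturality := fun A B f => ObjectProperty.hom_ext _ (τ.naturality f.hom) }
  obtain ⟨e, he⟩ := exists_iso_of_isIso_app σ fun A => isIso_of_isIso_hom _ (h A.obj A.property)
  exact ⟨e, fun A => by rw [he]; rfl⟩

/-- The natural morphism `D(A) ⟶ D(Â)`. -/
def mapToCompletion (D : CosimpAlg k ⥤ CDGA k) : D ⟶ completion k ⋙ D where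
  app A := D.map ((toCompletion k).app A)
  naturality A B f := by
    change D.map f ≫ D.map _ = D.map _ ≫ D.map ((completion k).map f)
    rw [← D.map_comp, ← D.map_comp]
    exact congrArg D.map ((toCompletion k).naturality f)

/-- The natural morphism from `K(C)` to its completion. -/
def toCompletionKalg (k : Type u) [Field k] : Kalg k ⟶ Kalg k ⋙ completion k where
  app C := (toCompletion k).app ((Kalg k).obj C)
  naturality _ _ f := (toCompletion k).naturality ((Kalg k).map f)

end CosimplicialDK

end

/-! ### The main theorem -/

theorem mainTheorem11 (k : Type u) [Field k] [CharZero k] :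
    (Kalg k).IsRightAdjoint ∧
    ∀ (D : CosimpAlg k ⥤ CDGA k) (adj : D ⊣ Kalg k),
      ∃ (hD : ∀ A, reducedFG k A → reducedFGCDGA k (D.obj A))
        (hK : ∀ C, reducedFGCDGA k C → reducedFG k ((Kalg k).obj C))
        (hc : ∀ A, reducedFG k A → reducedComplete k ((completion k).obj A))
        (hD' : ∀ A, reducedComplete k A → reducedFGCDGA k (D.obj A))
        (hK' : ∀ C, reducedFGCDGA k C → reducedComplete k ((Kalg k).obj C)),
        -- the adjunction restricts to finitely generated reduced algebras
        (∃ adj₁ : restrict D hD ⊣ restrict (Kalg k) hK,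
          (∀ A, (adj₁.unit.app A).hom = adj.unit.app A.obj) ∧
          (∀ C, (adj₁.counit.app C).hom = adj.counit.app C.obj)) ∧
        -- `D` is invariant under completion
        (∀ A : CosimpAlg k, A.IsReduced →
          (D.obj A).IsReduced ∧ (D.obj ((completion k).obj A)).IsReduced) ∧
        (∃ e : (reducedFGIdeal k).ι ⋙ completion k ⋙ D ≅ (reducedFGIdeal k).ι ⋙ D,
          ∀ A, e.inv.app A = D.map ((toCompletion k).app A.obj)) ∧
        -- the adjunction extends along the completion functor
        (∃ adj₂ : restrict D hD' ⊣ restrict (Kalg k) hK',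
          (∀ A, (adj₂.unit.app A).hom = adj.unit.app A.obj) ∧
          (∀ C, (adj₂.counit.app C).hom = adj.counit.app C.obj)) ∧
        (∃ e : restrict (completion k) hc ⋙ restrict D hD' ≅ restrict D hD,
          ∀ A, (e.inv.app A).hom = D.map ((toCompletion k).app A.obj)) ∧
        (∃ e : restrict (Kalg k) hK ⋙ restrict (completion k) hc ≅ restrict (Kalg k) hK',
          ∀ C, (e.inv.app C).hom = (toCompletion k).app ((Kalg k).obj C.obj)) := by
  refine ⟨isRightAdjoint_Kalg, fun D adj => ?_⟩
  refine ⟨fun A hA => reducedFGCDGA_of_adj adj (reducedFGIdeal_of_reducedFG hA),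
    fun C hC => reducedFG_Kalg hC,
    fun A hA => reducedComplete_completion (reducedFGIdeal_of_reducedFG hA),
    fun A hA => reducedFGCDGA_of_adj adj (reducedFGIdeal_of_reducedComplete hA),
    fun C hC => reducedComplete_Kalg hC,
    exists_restrict_adjunction adj _ _,
    fun A hA => ⟨isReduced_of_adj adj hA, isReduced_of_adj adj (isReduced_completion hA)⟩,
    exists_iso_of_isIso_app (Functor.whiskerLeft (reducedFGIdeal k).ι (mapToCompletion D))
      fun A => isIso_map_toCompletion adj A.property.2,
    exists_restrict_adjunction adj _ _,
    exists_restrict_iso _ _ _ (mapToCompletion D) fun A hA =>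
      isIso_map_toCompletion adj (reducedFGIdeal_of_reducedFG hA).2,
    exists_restrict_iso _ _ _ (toCompletionKalg k) fun C _ => isIso_toCompletion_Kalg C⟩
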